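/- Let $p\in[1,\infty)$ and let $A$ be a unital $L^p$-operator algebra, that is, a complex Banach algebra with a unit of norm $1$ that admits an isometric (not necessarily unital) algebra homomorphism $A\to\mathcal{B}(L^p(\mu))$ for some measure space $(X,\Sigma,\mu)$, where $L^p(\mu)$ is the complex $L^p$-space. For a complex Banach algebra $B$ with a unit of norm $1$, let $B_{\mathrm{h}}=\{b\in B:\|\exp(itb)\|=1\text{ for all }t\in\mathbb{R}\}$ be the set of its hermitian elements. A closed subalgebra $B\subseteq A$ containing the unit of $A$ is called a unital $C^*$-subalgebra of $A$ if $B=B_{\mathrm{h}}+iB_{\mathrm{h}}$. Set $\mathrm{core}(A):=A_{\mathrm{h}}+iA_{\mathrm{h}}$. Then $\mathrm{core}(A)$ is the largest unital $C^*$-subalgebra of $A$: it is a unital $C^*$-subalgebra of $A$, and it contains every unital $C^*$-subalgebra of $A$. If $p\neq 2$, then $\mathrm{core}(A)$ is commutative. -/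

import Mathlib

open MeasureTheory
open scoped ENNReal

universe u v

/-- An element `a` of a unital complex Banach algebra is hermitian if `‖exp (i t a)‖ = 1` for
every real number `t`. -/
def IsHermitianElement {A : Type*} [NormedRing A] [NormedAlgebra ℂ A] (a : A) : Prop :=
  ∀ t : ℝ, ‖NormedSpace.exp ((Complex.I * (t : ℂ)) • a)‖ = 1

/-- The set `A_h` of hermitian elements of `A`. -/
def hermitianElements (A : Type*) [NormedRing A] [NormedAlgebra ℂ A] : Set A :=
  {a : A | IsHermitianElement a}

/-- The set `core A = A_h + i A_h`. -/
def core (A : Type*) [NormedRing A] [NormedAlgebra ℂ A] : Set A :=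
  {a : A | ∃ x ∈ hermitianElements A, ∃ y ∈ hermitianElements A, a = x + Complex.I • y}

/-- A unital subalgebra `B` of `A` (with the unit and the norm of `A`) is a unital C⋆-subalgebra
if it is closed and `B = B_h + i B_h`, where `B_h` is the set of hermitian elements of the Banach
algebra `B`. -/
structure IsUnitalCStarSubalgebra {A : Type*} [NormedRing A] [NormedAlgebra ℂ A]
    (B : Subalgebra ℂ A) : Prop where
  isClosed : IsClosed (B : Set A)
  core_eq_univ : core B = Set.univ

/-- `A` is an `L^p`-operator algebra if it admits an isometric representation on the complex
`L^p`-space of some measure space. The representation is a homomorphism of complex algebras,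
and it need not map a unit of `A` to the identity operator. -/
def IsLpOperatorAlgebra (p : ℝ≥0∞) [Fact (1 ≤ p)] (A : Type u) [NormedRing A]
    [NormedAlgebra ℂ A] : Prop :=
  ∃ (X : Type v) (_ : MeasurableSpace X) (μ : Measure X)
    (φ : A →ₙₐ[ℂ] (Lp ℂ p μ →L[ℂ] Lp ℂ p μ)), Isometry φ

/-!
Let `φ` be an isometric representation of `A` on `L^p(μ)`. It need not be unital, so `e = φ 1` is a
contractive projection, and `A` acts faithfully on its range `E`. An element `a` is hermitian exactly
if the operators `φ (exp (i t a))` are isometries of `E`. Everything follows from a description of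
the hermitian elements by their action on `E`; given that they are closed under addition, that their
products lie in the core, and that `‖a‖ ≤ ‖a + i b‖` for hermitian `a` and `b`, the core is a closed
subalgebra (`exists_isGreatest_core`).

For `p = 2` the hermitian elements are those that are symmetric on the Hilbert space `E`
(`isHermitianElement_iff_isSymmetricOn`).

For `p ≠ 2` they are those that act by real multipliers, `φ a F = m F` with `m` a real function, on
every `F` in `E` (`isHermitianElement_iff_isRealMultiplierOn`); such multipliers commute and form a
real algebra. To see that a hermitian element acts in this way, note that disjointness of supports
is a metric property for `p ≠ 2` (`mul_ae_eq_zero_iff_norm`), hence is preserved by isometries of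
`E`. Differentiating, `φ a G` vanishes on the support of `F` if `F` and `G` in `E` are disjoint. This
is conclusive because `E` contains many disjoint functions: it is stable under restricting `G` to the
support of `F`, and `F` to the set where `Im (G / F) > 0` (`isLocalizable_fixedFunctions`). The first
operation shows that `φ a F` is supported on the support of `F`. With `G = φ a F`, the second one
isolates a part of `F` on which the multiplier has positive imaginary part, and this part vanishes
since its norm would grow along `φ (exp (-i t a))`.

The range `E` of a contractive projection on `L^p`, `p ≠ 2`, is localizable for different reasons
when `p = 1` and when `p > 1`. For `p = 1`, a contraction that fixes `F` induces a positive operator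
on the multipliers of `F`, and fixed points of a positive contraction form a lattice. For `p > 1`,
smoothness and strict convexity of the norm imply that the nonlinear map `F ↦ |F|^(p-2) F` takes `E`
onto the linear space `E'` of functions in the dual `L^q` that annihilate the kernel of the
projection (`isDualPair_of_contractive_projection`). If `p > 2`, differentiate this map: `E'` contains
`|F|^(p-2) G` and `|F|^(p-2) (F / conj F) conj G`. Pulling the first function back to `E` and
iterating gives `|F| sgn G` in `E`, and the second one gives access to `Im (G / F)`. If `p < 2`,
exchange the roles of `E` and `E'`.
-/

open Filter Topology ComplexConjugate

/-! ### The duality map -/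

/-- The duality map `z ↦ |z|^(r-2) z`; applied pointwise it sends `L^r` onto its dual `L^(r/(r-1))`.
At `z = 0` its value is `0`, whatever `r` is. -/
noncomputable def dualityMap (r : ℝ) (z : ℂ) : ℂ := ((‖z‖ ^ (r - 2) : ℝ) : ℂ) * z

@[simp] lemma dualityMap_zero (r : ℝ) : dualityMap r 0 = 0 := by simp [dualityMap]

lemma norm_dualityMap {r : ℝ} (hr : 1 < r) (z : ℂ) : ‖dualityMap r z‖ = ‖z‖ ^ (r - 1) := by
  rcases eq_or_ne z 0 with rfl | hz
  · simp [Real.zero_rpow (by linarith : r - 1 ≠ 0)]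
  · have : 0 < ‖z‖ := norm_pos_iff.2 hz
    rw [dualityMap, norm_mul, Complex.norm_real, Real.norm_of_nonneg (by positivity)]
    rw [show r - 1 = (r - 2) + 1 by ring, Real.rpow_add this, Real.rpow_one]

lemma dualityMap_eq_zero_iff {r : ℝ} (z : ℂ) : dualityMap r z = 0 ↔ z = 0 := by
  constructor
  · intro h
    by_contra hz
    have : 0 < ‖z‖ := norm_pos_iff.2 hz
    have h2 : (0 : ℝ) < ‖z‖ ^ (r - 2) := by positivity
    rcases mul_eq_zero.1 h with h | h
    · exact h2.ne' (by exact_mod_cast h)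
    · exact hz h
  · rintro rfl; simp

lemma dualityMap_dualityMap {p q : ℝ} (h : p.HolderConjugate q) (z : ℂ) :
    dualityMap q (dualityMap p z) = z := by
  rcases eq_or_ne z 0 with rfl | hz
  · simp
  · have hz' : 0 < ‖z‖ := norm_pos_iff.2 hz
    rw [dualityMap, norm_dualityMap h.lt, dualityMap, ← mul_assoc, ← Complex.ofReal_mul,
      ← Real.rpow_mul hz'.le, ← Real.rpow_add hz']
    have : (p - 1) * (q - 2) + (p - 2) = 0 := by
      have := h.mul_eq_add
      linarith
    rw [this]; simp

lemma dualityMap_div_norm (r : ℝ) (z : ℂ) : dualityMap r z / ‖dualityMap r z‖ = z / ‖z‖ := by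
  rcases eq_or_ne z 0 with rfl | hz
  · simp
  · have hz' : 0 < ‖z‖ := norm_pos_iff.2 hz
    have h2 : (0 : ℝ) < ‖z‖ ^ (r - 2) := by positivity
    rw [dualityMap, norm_mul, Complex.norm_real, Real.norm_of_nonneg h2.le, Complex.ofReal_mul,
      mul_div_mul_left _ _ (by exact_mod_cast h2.ne')]

lemma continuous_dualityMap {r : ℝ} (hr : 1 < r) : Continuous (dualityMap r) := by
  rw [continuous_iff_continuousAt]
  intro z
  rcases eq_or_ne z 0 with rfl | hz
  · rw [ContinuousAt, dualityMap_zero, tendsto_zero_iff_norm_tendsto_zero]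
    simp_rw [norm_dualityMap hr]
    have : ContinuousAt (fun z : ℂ => ‖z‖ ^ (r - 1)) 0 :=
      (continuous_norm.continuousAt).rpow_const (Or.inr (by linarith))
    simpa [ContinuousAt, Real.zero_rpow (by linarith : r - 1 ≠ 0)] using this
  · unfold dualityMap
    refine ContinuousAt.mul (Complex.continuous_ofReal.continuousAt.comp ?_) continuousAt_id
    exact (continuous_norm.continuousAt).rpow_const (Or.inl (norm_ne_zero_iff.2 hz))

/-- The complex linear part of the real derivative of the duality map. -/
noncomputable def dualityMapLin (r : ℝ) (z w : ℂ) : ℂ := ((‖z‖ ^ (r - 2) : ℝ) : ℂ) * w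

/-- The conjugate linear part of the real derivative of the duality map. -/
noncomputable def dualityMapConj (r : ℝ) (z w : ℂ) : ℂ :=
  ((‖z‖ ^ (r - 2) : ℝ) : ℂ) * (z / conj z) * conj w

/-- The real derivative of the duality map at `z` in the direction `w`. -/
noncomputable def dualityMapDeriv (r : ℝ) (z w : ℂ) : ℂ :=
  (r / 2 : ℂ) * dualityMapLin r z w + ((r - 2) / 2 : ℂ) * dualityMapConj r z w

lemma norm_dualityMapDeriv_le {r : ℝ} (hr : 2 < r) (z w : ℂ) :
    ‖dualityMapDeriv r z w‖ ≤ (r - 1) * (‖z‖ ^ (r - 2) * ‖w‖) := by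
  have h0 : (0 : ℝ) ≤ ‖z‖ ^ (r - 2) := by positivity
  have h1 : ‖dualityMapLin r z w‖ = ‖z‖ ^ (r - 2) * ‖w‖ := by
    rw [dualityMapLin, norm_mul, Complex.norm_real, Real.norm_of_nonneg h0]
  have h2 : ‖dualityMapConj r z w‖ ≤ ‖z‖ ^ (r - 2) * ‖w‖ := by
    rw [dualityMapConj, norm_mul, norm_mul, Complex.norm_real, Real.norm_of_nonneg h0, norm_div,
      RCLike.norm_conj, RCLike.norm_conj]
    gcongr
    exact mul_le_of_le_one_right h0 (div_self_le_one _)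
  have e1 : ‖(r / 2 : ℂ)‖ = r / 2 := by
    rw [← Complex.ofReal_ofNat, ← Complex.ofReal_div, Complex.norm_real,
      Real.norm_of_nonneg (by linarith)]
  have e2 : ‖((r - 2) / 2 : ℂ)‖ = (r - 2) / 2 := by
    rw [← Complex.ofReal_ofNat, ← Complex.ofReal_sub, ← Complex.ofReal_div, Complex.norm_real,
      Real.norm_of_nonneg (by linarith)]
  calc _ ≤ _ := norm_add_le _ _
    _ = r / 2 * ‖dualityMapLin r z w‖ + (r - 2) / 2 * ‖dualityMapConj r z w‖ := by
      rw [norm_mul, norm_mul, e1, e2]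
    _ ≤ r / 2 * (‖z‖ ^ (r - 2) * ‖w‖) + (r - 2) / 2 * (‖z‖ ^ (r - 2) * ‖w‖) := by
      rw [h1]; gcongr
    _ = _ := by ring

lemma hasDerivAt_dualityMap_zero {r : ℝ} (hr : 2 < r) (z w : ℂ) :
    HasDerivAt (fun t : ℝ => dualityMap r (z + t * w)) (dualityMapDeriv r z w) 0 := by
  rcases eq_or_ne z 0 with rfl | hz
  · have : dualityMapDeriv r 0 w = 0 := by
      simp [dualityMapDeriv, dualityMapLin, dualityMapConj]
      right; left; rw [Real.zero_rpow (by linarith)]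
    rw [this, hasDerivAt_iff_isLittleO]
    simp only [zero_add, Complex.ofReal_zero, zero_mul, dualityMap_zero, sub_zero, smul_zero]
    have h1 : ∀ t : ℝ, ‖dualityMap r (t * w)‖ = (‖(t : ℂ) * w‖ ^ (r - 2) * ‖w‖) * ‖t‖ := by
      intro t
      rw [dualityMap, norm_mul, Complex.norm_real, Real.norm_of_nonneg (by positivity),
        norm_mul (t : ℂ) w, Complex.norm_real]
      ring
    have h2 : ContinuousAt (fun t : ℝ => ‖(t : ℂ) * w‖ ^ (r - 2) * ‖w‖) 0 :=
      ContinuousAt.mul (ContinuousAt.rpow_const (by fun_prop) (Or.inr (by linarith)))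
        continuousAt_const
    have h3 : Tendsto (fun t : ℝ => ‖(t : ℂ) * w‖ ^ (r - 2) * ‖w‖) (𝓝 0) (𝓝 0) := by
      simpa [ContinuousAt, Real.zero_rpow (by linarith : r - 2 ≠ 0)] using h2
    rw [← Asymptotics.isLittleO_norm_left]
    simp_rw [h1]
    have h4 : (fun t : ℝ => ‖(t : ℂ) * w‖ ^ (r - 2) * ‖w‖) =o[𝓝 0] (fun _ => (1 : ℝ)) :=
      (Asymptotics.isLittleO_one_iff ℝ).2 h3
    have h5 : (fun t : ℝ => ‖t‖) =O[𝓝 0] (fun t : ℝ => t) :=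
      (Asymptotics.isBigO_refl (fun t : ℝ => t) _).norm_left
    simpa using h4.mul_isBigO h5
  · have hz' : 0 < ‖z‖ := norm_pos_iff.2 hz
    have hline : HasDerivAt (fun t : ℝ => z + t * w) w 0 := by
      have := ((Complex.ofRealCLM.hasDerivAt (x := 0)).mul_const w).const_add z
      simpa using this
    have hsq := hline.norm_sq
    have hpow := hsq.rpow_const (p := (r - 2) / 2) (Or.inl (by simpa using hz))
    have e : ∀ x : ℂ, (‖x‖ ^ 2) ^ ((r - 2) / 2) = ‖x‖ ^ (r - 2) := by
      intro x
      rw [← Real.rpow_natCast, ← Real.rpow_mul (norm_nonneg _)]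
      congr 1; push_cast; ring
    simp_rw [e] at hpow
    have := (hpow.ofReal_comp).mul hline
    refine this.congr_deriv ?_
    have h3 : ((‖z‖ ^ 2) ^ ((r - 2) / 2 - 1) : ℝ) = ‖z‖ ^ (r - 2) / ‖z‖ ^ 2 := by
      rw [Real.rpow_sub (by positivity), e, Real.rpow_one]
    have h4 : ((inner ℝ z w : ℝ) : ℂ) = (conj z * w + z * conj w) / 2 := by
      rw [Complex.inner, Complex.re_eq_add_conj]
      simp; ring
    have h5 : ((‖z‖ ^ 2 : ℝ) : ℂ) = z * conj z := by
      rw [Complex.mul_conj, Complex.normSq_eq_norm_sq]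
    simp only [Complex.ofReal_zero, zero_mul, add_zero, h3, dualityMapDeriv, dualityMapLin,
      dualityMapConj]
    push_cast [h4]
    have hc : conj z ≠ 0 := by simpa using hz
    rw [show ((‖z‖ : ℂ) ^ 2) = z * conj z by rw [← h5]; push_cast; rfl]
    field_simp
    ring

lemma hasDerivAt_dualityMap {r : ℝ} (hr : 2 < r) (z w : ℂ) (s : ℝ) :
    HasDerivAt (fun t : ℝ => dualityMap r (z + t * w)) (dualityMapDeriv r (z + s * w) w) s := by
  have h := hasDerivAt_dualityMap_zero hr (z + s * w) w
  have h2 : HasDerivAt (fun t : ℝ => t - s) 1 s := (hasDerivAt_id s).sub_const s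
  have h3 := HasDerivAt.scomp (h := fun t : ℝ => t - s) s (by simpa using h) h2
  refine (h3.congr_deriv (by simp)).congr_of_eventuallyEq ?_
  filter_upwards with t
  simp only [Function.comp]
  congr 1; push_cast; ring

lemma norm_dualityMap_sub_le {r : ℝ} (hr : 2 < r) (z w : ℂ) {t : ℝ} (h0 : 0 < t) (h1 : t ≤ 1) :
    ‖dualityMap r (z + t * w) - dualityMap r z‖ ≤ (r - 1) * (‖z‖ + ‖w‖) ^ (r - 1) * t := by
  have := (convex_Icc (0 : ℝ) 1).norm_image_sub_le_of_norm_hasDerivWithin_le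
    (f := fun t : ℝ => dualityMap r (z + t * w)) (C := (r - 1) * (‖z‖ + ‖w‖) ^ (r - 1))
    (fun s _ => (hasDerivAt_dualityMap hr z w s).hasDerivWithinAt) ?_
    (x := 0) (y := t) ⟨le_rfl, zero_le_one⟩ ⟨h0.le, h1⟩
  · simpa [abs_of_pos h0] using this
  · intro s hs
    refine (norm_dualityMapDeriv_le hr _ _).trans ?_
    have : ‖z + s * w‖ ≤ ‖z‖ + ‖w‖ := by
      refine (norm_add_le _ _).trans ?_
      rw [norm_mul, Complex.norm_real, Real.norm_of_nonneg hs.1]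
      have := mul_le_of_le_one_left (norm_nonneg w) hs.2
      linarith
    have hb : 0 ≤ ‖z‖ + ‖w‖ := by positivity
    calc _ ≤ (r - 1) * ((‖z‖ + ‖w‖) ^ (r - 2) * (‖z‖ + ‖w‖)) := by
          gcongr <;> linarith [norm_nonneg z]
      _ = _ := by
        rw [← Real.rpow_add_one' hb (by linarith)]; congr 2; ring

/-! ### Function spaces paired by the duality map -/

section DualPair

variable {X : Type*} [MeasurableSpace X] {μ : Measure X}

lemma MeasureTheory.MemLp.norm_rpow_sub_one {E : Type*} [NormedAddCommGroup E] {p q : ℝ}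
    (h : p.HolderConjugate q) {f : X → E}
    (hf : MemLp f (ENNReal.ofReal p) μ) :
    MemLp (fun x => ‖f x‖ ^ (p - 1)) (ENNReal.ofReal q) μ := by
  have h1 : 0 < p - 1 := by linarith [h.lt]
  have := hf.norm_rpow_div (ENNReal.ofReal (p - 1))
  rw [ENNReal.toReal_ofReal h1.le, ← ENNReal.ofReal_div_of_pos h1] at this
  rwa [h.conjugate_eq]

lemma MeasureTheory.MemLp.dualityMap {p q : ℝ} (h : p.HolderConjugate q) {f : X → ℂ}
    (hf : MemLp f (ENNReal.ofReal p) μ) :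
    MemLp (fun x => dualityMap p (f x)) (ENNReal.ofReal q) μ := by
  refine (hf.norm_rpow_sub_one h).congr_norm
    ((continuous_dualityMap h.lt).comp_aestronglyMeasurable hf.1) (.of_forall fun x => ?_)
  rw [norm_dualityMap h.lt, Real.norm_of_nonneg (by positivity)]

/-- A complex linear space of `L^r` functions that is closed under dominated convergence; this
makes it invariant under changes on null sets as well. -/
structure IsDominatedClosed (μ : Measure X) (r : ℝ) (M : Submodule ℂ (X → ℂ)) : Prop where
  memLp : ∀ f ∈ M, MemLp f (ENNReal.ofReal r) μ
  closed : ∀ (u : ℕ → X → ℂ) (f : X → ℂ) (G : X → ℝ), (∀ n, u n ∈ M) →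
    MemLp G (ENNReal.ofReal r) μ → (∀ n, ∀ᵐ x ∂μ, ‖u n x‖ ≤ G x) →
    (∀ᵐ x ∂μ, Tendsto (fun n => u n x) atTop (𝓝 (f x))) → f ∈ M

lemma IsDominatedClosed.congr {r : ℝ} {M : Submodule ℂ (X → ℂ)} (hM : IsDominatedClosed μ r M)
    {f g : X → ℂ} (hf : f ∈ M) (h : f =ᵐ[μ] g) : g ∈ M := by
  refine hM.closed (fun _ => f) g (fun x => ‖f x‖) (fun _ => hf) (hM.memLp f hf).norm
    (fun _ => .of_forall fun x => le_rfl) ?_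
  filter_upwards [h] with x hx
  rw [hx]; exact tendsto_const_nhds

/-- Two spaces of functions, in `L^r` and in the dual `L^s`, that correspond to each other under the
duality map. For the range `M` of a contractive projection `e` on `L^r`, this holds with the range
of the adjoint of `e` as `M'`. -/
structure IsDualPair (μ : Measure X) (r s : ℝ) (M M' : Submodule ℂ (X → ℂ)) : Prop where
  exponents : r.HolderConjugate s
  left : IsDominatedClosed μ r M
  right : IsDominatedClosed μ s M'
  mem_iff : ∀ f : X → ℂ, f ∈ M ↔ (fun x => dualityMap r (f x)) ∈ M'

lemma IsDualPair.symm {r s : ℝ} {M M' : Submodule ℂ (X → ℂ)} (h : IsDualPair μ r s M M') :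
    IsDualPair μ s r M' M where
  exponents := h.exponents.symm
  left := h.right
  right := h.left
  mem_iff f := by
    rw [h.mem_iff]
    simp_rw [dualityMap_dualityMap h.exponents.symm]

/-- A space of functions is stable under the localizations that matter for a contractive
projection: restriction of `g` to the support of `f`, and restriction of `f` to the set where
`g / f` has positive imaginary part. -/
structure IsLocalizable (M : Submodule ℂ (X → ℂ)) : Prop where
  restrict : ∀ f ∈ M, ∀ g ∈ M, {x | f x ≠ 0}.indicator g ∈ M
  restrict_im : ∀ f ∈ M, ∀ g ∈ M, {x | 0 < (g x * conj (f x)).im}.indicator f ∈ M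

variable {r s : ℝ} {M M' : Submodule ℂ (X → ℂ)}

/-- Since `M'` is a closed linear space that contains the image of `M` under the duality map, it
contains the derivatives of this map along `M`. -/
lemma IsDualPair.deriv_mem (h : IsDualPair μ r s M M') (hr : 2 < r) {f g : X → ℂ} (hf : f ∈ M)
    (hg : g ∈ M) : (fun x => dualityMapDeriv r (f x) (g x)) ∈ M' := by
  have hfg : MemLp (fun x => ‖f x‖ + ‖g x‖) (ENNReal.ofReal r) μ :=
    (h.left.memLp f hf).norm.add (h.left.memLp g hg).norm
  have hG : MemLp (fun x => (r - 1) * (‖f x‖ + ‖g x‖) ^ (r - 1)) (ENNReal.ofReal s) μ := by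
    refine MemLp.const_mul ?_ _
    refine (hfg.norm_rpow_sub_one h.exponents).congr_norm ?_ (.of_forall fun x => ?_)
    · exact (hfg.1.aemeasurable.pow_const _).aestronglyMeasurable
    · rw [Real.norm_of_nonneg (by positivity : 0 ≤ ‖f x‖ + ‖g x‖)]
  let t : ℕ → ℝ := fun n => 1 / ((n : ℝ) + 1)
  have ht0 : ∀ n, 0 < t n := fun n => by positivity
  have ht1 : ∀ n, t n ≤ 1 := fun n => by
    rw [div_le_one (by positivity)]; linarith [(Nat.cast_nonneg n : (0 : ℝ) ≤ n)]
  refine h.right.closed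
    (fun n x => (t n)⁻¹ • (dualityMap r (f x + t n * g x) - dualityMap r (f x))) _ _ ?_ hG ?_ ?_
  · intro n
    have h1 : (fun x => dualityMap r (f x + t n * g x)) ∈ M' :=
      (h.mem_iff _).1 (M.add_mem hf (M.smul_mem (t n : ℂ) hg))
    have := M'.smul_mem (((t n)⁻¹ : ℝ) : ℂ) (M'.sub_mem h1 ((h.mem_iff _).1 hf))
    exact this
  · refine fun n => .of_forall fun x => ?_
    rw [norm_smul, norm_inv, Real.norm_of_nonneg (ht0 n).le, inv_mul_le_iff₀ (ht0 n)]
    refine (norm_dualityMap_sub_le hr (f x) (g x) (ht0 n) (ht1 n)).trans (le_of_eq ?_)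
    ring
  · refine .of_forall fun x => ?_
    have h1 := (hasDerivAt_iff_tendsto_slope.1 (hasDerivAt_dualityMap_zero hr (f x) (g x)))
    have h2 : Tendsto t atTop (𝓝[≠] 0) := by
      rw [tendsto_nhdsWithin_iff]
      exact ⟨tendsto_one_div_add_atTop_nhds_zero_nat, .of_forall fun n => (ht0 n).ne'⟩
    refine (h1.comp h2).congr fun n => ?_
    simp [slope]

lemma IsDualPair.lin_mem (h : IsDualPair μ r s M M') (hr : 2 < r) {f g : X → ℂ} (hf : f ∈ M)
    (hg : g ∈ M) : (fun x => dualityMapLin r (f x) (g x)) ∈ M' := by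
  have h1 := h.deriv_mem hr hf hg
  have h2 := h.deriv_mem hr hf (M.smul_mem Complex.I hg)
  convert M'.smul_mem (1 / r : ℂ) (M'.sub_mem h1 (M'.smul_mem Complex.I h2)) using 1
  have : (r : ℂ) ≠ 0 := by exact_mod_cast (by linarith : r ≠ 0)
  ext x
  simp only [Pi.smul_apply, Pi.sub_apply, smul_eq_mul, dualityMapDeriv, dualityMapLin,
    dualityMapConj, map_mul, Complex.conj_I]
  field_simp
  ring_nf
  simp only [Complex.I_sq]
  ring

lemma IsDualPair.conj_mem (h : IsDualPair μ r s M M') (hr : 2 < r) {f g : X → ℂ} (hf : f ∈ M)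
    (hg : g ∈ M) : (fun x => dualityMapConj r (f x) (g x)) ∈ M' := by
  have h1 := h.deriv_mem hr hf hg
  have h2 := h.deriv_mem hr hf (M.smul_mem Complex.I hg)
  convert M'.smul_mem (1 / (r - 2) : ℂ) (M'.add_mem h1 (M'.smul_mem Complex.I h2)) using 1
  have : (r - 2 : ℂ) ≠ 0 := by exact_mod_cast (by linarith : r - 2 ≠ 0)
  ext x
  simp only [Pi.smul_apply, Pi.add_apply, smul_eq_mul, dualityMapDeriv, dualityMapLin,
    dualityMapConj, map_mul, Complex.conj_I]
  rw [← sub_eq_zero]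
  field_simp
  ring_nf
  simp only [Complex.I_sq]
  ring

/-- The geometric interpolation `|z|^(1-θ) |w|^θ sgn w` from `w`, at `θ = 1`, to `|z| sgn w`. -/
noncomputable def geomMix (θ : ℝ) (z w : ℂ) : ℂ :=
  ((‖z‖ ^ (1 - θ) * ‖w‖ ^ θ : ℝ) : ℂ) * (w / ‖w‖)

lemma norm_geomMix_le {θ : ℝ} (h0 : 0 ≤ θ) (h1 : θ ≤ 1) (z w : ℂ) :
    ‖geomMix θ z w‖ ≤ ‖z‖ + ‖w‖ := by
  have hz := norm_nonneg z
  have hw := norm_nonneg w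
  rw [geomMix, norm_mul, norm_div, Complex.norm_real, Complex.norm_real, norm_norm,
    Real.norm_of_nonneg (by positivity)]
  refine (mul_le_of_le_one_right (by positivity) (div_self_le_one _)).trans ?_
  refine (Real.geom_mean_le_arith_mean2_weighted (by linarith) h0 hz hw (by ring)).trans ?_
  nlinarith

lemma tendsto_geomMix {θ : ℕ → ℝ} (hθ : Tendsto θ atTop (𝓝 0)) (z w : ℂ) :
    Tendsto (fun n => geomMix (θ n) z w) atTop (𝓝 (‖z‖ * (w / ‖w‖))) := by
  rcases eq_or_ne w 0 with rfl | hw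
  · simp [geomMix]
  have hw' : 0 < ‖w‖ := norm_pos_iff.2 hw
  unfold geomMix
  refine Tendsto.mul_const _ ((Complex.continuous_ofReal.tendsto _).comp ?_)
  have e : ‖z‖ = ‖z‖ ^ (1 - (0 : ℝ)) * ‖w‖ ^ (0 : ℝ) := by simp
  rw [show 𝓝 ‖z‖ = 𝓝 (‖z‖ ^ (1 - (0 : ℝ)) * ‖w‖ ^ (0 : ℝ)) by rw [← e]]
  refine Tendsto.mul ?_ ?_
  · exact tendsto_const_nhds.rpow (tendsto_const_nhds.sub hθ) (Or.inr (by norm_num))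
  · exact tendsto_const_nhds.rpow hθ (Or.inl hw'.ne')

/-- Passing from `g` to the function whose image under the duality map is `|f|^(r-2) g` multiplies
the exponent `θ` by `1 / (r - 1)`. -/
lemma dualityMap_geomMix (hr : 2 < r) {θ : ℝ} (h0 : 0 < θ) (h1 : θ ≤ 1) (z w : ℂ) :
    dualityMap r (geomMix (θ / (r - 1)) z w) = dualityMapLin r z (geomMix θ z w) := by
  rcases eq_or_ne w 0 with rfl | hw
  · simp [geomMix, dualityMapLin]
  have hw' : 0 < ‖w‖ := norm_pos_iff.2 hw
  have hr1 : 0 < r - 1 := by linarith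
  have hθ : θ / (r - 1) < 1 := by rw [div_lt_one hr1]; linarith
  have hn : ‖geomMix (θ / (r - 1)) z w‖ = ‖z‖ ^ (1 - θ / (r - 1)) * ‖w‖ ^ (θ / (r - 1)) := by
    rw [geomMix, norm_mul, norm_div, Complex.norm_real, Complex.norm_real, norm_norm,
      div_self hw'.ne', mul_one, Real.norm_of_nonneg (by positivity)]
  rw [dualityMap, hn, dualityMapLin, geomMix, geomMix, ← mul_assoc, ← mul_assoc,
    ← Complex.ofReal_mul, ← Complex.ofReal_mul]
  congr 2
  rcases eq_or_ne z 0 with rfl | hz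
  · rw [norm_zero, Real.zero_rpow (by linarith : 1 - θ / (r - 1) ≠ 0),
      Real.zero_rpow (by linarith : r - 2 ≠ 0)]
    simp
  have hz' : 0 < ‖z‖ := norm_pos_iff.2 hz
  rw [Real.mul_rpow (by positivity) (by positivity), ← Real.rpow_mul hz'.le, ← Real.rpow_mul hw'.le,
    mul_mul_mul_comm, ← Real.rpow_add hz', ← Real.rpow_add hw', ← mul_assoc, ← Real.rpow_add hz']
  congr 2 <;> field_simp <;> ring

lemma IsDualPair.geomMix_mem (h : IsDualPair μ r s M M') (hr : 2 < r) {f g : X → ℂ} (hf : f ∈ M)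
    (hg : g ∈ M) (n : ℕ) : (fun x => geomMix ((1 / (r - 1)) ^ n) (f x) (g x)) ∈ M := by
  have hr1 : 0 < r - 1 := by linarith
  induction n with
  | zero =>
    convert hg using 2 with x
    rcases eq_or_ne (g x) 0 with hw | hw
    · simp [geomMix, hw]
    · have : (‖g x‖ : ℂ) ≠ 0 := by simpa using hw
      simp [geomMix]; field_simp
  | succ n ih =>
    rw [h.mem_iff]
    convert h.lin_mem hr hf ih using 2 with x
    rw [← dualityMap_geomMix hr (by positivity)
      (pow_le_one₀ (by positivity) (by rw [div_le_one hr1]; linarith)), pow_succ, mul_one_div]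

lemma IsDualPair.norm_mul_sign_mem (h : IsDualPair μ r s M M') (hr : 2 < r) {f g : X → ℂ}
    (hf : f ∈ M) (hg : g ∈ M) : (fun x => ‖f x‖ * (g x / ‖g x‖) : X → ℂ) ∈ M := by
  have hr1 : 0 < r - 1 := by linarith
  have hr2 : 1 / (r - 1) < 1 := by rw [div_lt_one hr1]; linarith
  refine h.left.closed _ _ (fun x => ‖f x‖ + ‖g x‖) (fun n => h.geomMix_mem hr hf hg n)
    ((h.left.memLp f hf).norm.add (h.left.memLp g hg).norm)
    (fun n => .of_forall fun x => norm_geomMix_le (by positivity)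
      (pow_le_one₀ (by positivity) hr2.le) _ _)
    (.of_forall fun x => tendsto_geomMix (tendsto_pow_atTop_nhds_zero_of_lt_one (by positivity) hr2)
      _ _)

lemma IsDualPair.restrict_mem (h : IsDualPair μ r s M M') (hr : 2 < r) {f g : X → ℂ}
    (hf : f ∈ M) (hg : g ∈ M) : {x | f x ≠ 0}.indicator g ∈ M := by
  convert h.norm_mul_sign_mem hr (h.norm_mul_sign_mem hr hg hf) hg using 2 with x
  rcases eq_or_ne (f x) 0 with hf0 | hf0
  · simp [hf0]
  rcases eq_or_ne (g x) 0 with hg0 | hg0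
  · simp [hf0, hg0]
  have h1 : (‖f x‖ : ℂ) ≠ 0 := by simpa using hf0
  have h2 : (‖g x‖ : ℂ) ≠ 0 := by simpa using hg0
  have : {x | f x ≠ 0}.indicator g x = g x := Set.indicator_of_mem hf0 _
  rw [this]
  simp [hf0]
  field_simp

lemma IsDualPair.restrict_im_mem (h : IsDualPair μ r s M M') (hr : 2 < r) {f g : X → ℂ}
    (hf : f ∈ M) (hg : g ∈ M) : {x | 0 < (g x * conj (f x)).im}.indicator f ∈ M := by
  -- `k` is `f` times a real function with the sign of `Im (g / f)`.
  let k : X → ℂ := fun x => dualityMap s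
    ((2 * Complex.I)⁻¹ * (dualityMapLin r (f x) (g x) - dualityMapConj r (f x) (g x)))
  have hk : k ∈ M := by
    rw [h.mem_iff]
    simp only [k, dualityMap_dualityMap h.exponents.symm]
    exact M'.smul_mem _ (M'.sub_mem (h.lin_mem hr hf hg) (h.conj_mem hr hf hg))
  have hk' : ∀ x, ∃ c : ℝ, 0 ≤ c ∧ (f x ≠ 0 → 0 < c) ∧
      (2 * Complex.I)⁻¹ * (dualityMapLin r (f x) (g x) - dualityMapConj r (f x) (g x)) =
        c * (g x * conj (f x)).im * f x := by
    intro x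
    refine ⟨‖f x‖ ^ (r - 2) / ‖f x‖ ^ 2, by positivity, fun hx => ?_, ?_⟩
    · have := norm_pos_iff.2 hx
      positivity
    · rcases eq_or_ne (f x) 0 with hf0 | hf0
      · simp [dualityMapLin, dualityMapConj, hf0, Real.zero_rpow (by linarith : r - 2 ≠ 0)]
      have hc : conj (f x) ≠ 0 := by simpa using hf0
      have h5 : ((‖f x‖ : ℂ) ^ 2) = f x * conj (f x) := by
        rw [Complex.mul_conj, Complex.normSq_eq_norm_sq]; push_cast; rfl
      rw [Complex.im_eq_sub_conj]
      push_cast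
      rw [h5]
      simp only [dualityMapLin, dualityMapConj, map_mul, Complex.conj_conj]
      field_simp
  have h1 := M.smul_mem (1 / 2 : ℂ) (M.add_mem (h.norm_mul_sign_mem hr hf hk)
    (h.restrict_mem hr hk hf))
  convert h1 using 1
  ext x
  obtain ⟨c, hc0, hc, hcx⟩ := hk' x
  have hkx : k x = dualityMap s (c * (g x * conj (f x)).im * f x) := by simp only [k]; rw [hcx]
  set y := (g x * conj (f x)).im with hy
  rcases eq_or_ne (f x) 0 with hf0 | hf0
  · have : k x = 0 := by rw [hkx, hf0]; simp
    simp only [Set.indicator_apply, Pi.smul_apply, Pi.add_apply, hf0, this]; simp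
  have hf1 : (‖f x‖ : ℂ) ≠ 0 := by simpa using hf0
  have hf2 : 0 < ‖f x‖ := norm_pos_iff.2 hf0
  have hcp := hc hf0
  have hk0 : k x ≠ 0 ↔ y ≠ 0 := by
    rw [hkx, Ne, dualityMap_eq_zero_iff]
    simp [hf0, hcp.ne']
  simp only [Set.indicator_apply, Set.mem_ofPred_eq, Pi.smul_apply, Pi.add_apply, ← hy]
  have hkn : k x / ‖k x‖ = y * f x / ((|y| : ℝ) * ‖f x‖) := by
    have hcc : (c : ℂ) ≠ 0 := by exact_mod_cast hcp.ne'
    rw [hkx, dualityMap_div_norm, norm_mul, norm_mul, Complex.norm_real, Complex.norm_real,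
      Real.norm_of_nonneg hc0, Real.norm_eq_abs]
    push_cast
    rw [mul_assoc, mul_assoc, mul_div_mul_left _ _ hcc]
  rcases lt_trichotomy y 0 with hy0 | hy0 | hy0
  · have hkn : ‖f x‖ * (k x / ‖k x‖) = - f x := by
      rw [hkn, abs_of_neg hy0]
      have : (y : ℂ) ≠ 0 := by exact_mod_cast hy0.ne
      push_cast
      field_simp
    rw [if_neg (by linarith), if_pos (hk0.2 hy0.ne), hkn]
    simp
  · have hk1 : k x = 0 := by by_contra h; exact (hk0.1 h) hy0
    simp [hy0, hk1]
  · have hkn : ‖f x‖ * (k x / ‖k x‖) = f x := by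
      rw [hkn, abs_of_pos hy0]
      have : (y : ℂ) ≠ 0 := by exact_mod_cast hy0.ne'
      field_simp
    rw [if_pos hy0, if_pos (hk0.2 hy0.ne'), hkn]
    simp; ring

theorem IsDualPair.isLocalizable_left (h : IsDualPair μ r s M M') (hr : 2 < r) :
    IsLocalizable M where
  restrict _ hf _ hg := h.restrict_mem hr hf hg
  restrict_im _ hf _ hg := h.restrict_im_mem hr hf hg

/-- Localizability passes from `M` to the dual space `M'`, because the duality map multiplies
functions by positive factors and commutes with restriction to sets. -/
theorem IsDualPair.isLocalizable_right (h : IsDualPair μ r s M M') (hr : 2 < r) :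
    IsLocalizable M' := by
  have key : ∀ f ∈ M', ∃ F ∈ M, ∀ x, f x = dualityMap r (F x) := fun f hf =>
    ⟨_, (h.symm.mem_iff f).1 hf, fun x => (dualityMap_dualityMap h.exponents.symm _).symm⟩
  refine ⟨fun f hf g hg => ?_, fun f hf g hg => ?_⟩
  all_goals
    obtain ⟨F, hF, hfF⟩ := key f hf
    obtain ⟨G, hG, hgG⟩ := key g hg
  · convert (h.mem_iff _).1 (h.restrict_mem hr hF hG) using 2 with x
    simp only [Set.indicator_apply, Set.mem_ofPred_eq, hfF, hgG, Ne, dualityMap_eq_zero_iff]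
    split_ifs <;> simp
  · convert (h.mem_iff _).1 (h.restrict_im_mem hr hF hG) using 2 with x
    have : (0 < (g x * conj (f x)).im) ↔ 0 < (G x * conj (F x)).im := by
      rcases eq_or_ne (F x) 0 with hF0 | hF0
      · simp [hfF, hF0]
      rcases eq_or_ne (G x) 0 with hG0 | hG0
      · simp [hgG, hG0]
      have h1 : 0 < ‖F x‖ ^ (r - 2) := by have := norm_pos_iff.2 hF0; positivity
      have h2 : 0 < ‖G x‖ ^ (r - 2) := by have := norm_pos_iff.2 hG0; positivity
      have e : g x * conj (f x) =
          ((‖G x‖ ^ (r - 2) * ‖F x‖ ^ (r - 2) : ℝ) : ℂ) * (G x * conj (F x)) := by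
        rw [hfF, hgG, dualityMap, dualityMap, map_mul, Complex.conj_ofReal]
        push_cast; ring
      rw [e, Complex.im_ofReal_mul, mul_pos_iff_of_pos_left (by positivity)]
    simp only [Set.indicator_apply, Set.mem_ofPred_eq, this]
    split_ifs
    · exact hfF x
    · simp

end DualPair

/-! ### Norms and dominated convergence in `L^p` -/

section Lp

variable {X : Type*} [MeasurableSpace X] {μ : Measure X} {p : ℝ≥0∞} [hp1 : Fact (1 ≤ p)]

lemma one_le_toReal_exponent (p : ℝ≥0∞) [hp1 : Fact (1 ≤ p)] (hp : p ≠ ∞) : 1 ≤ p.toReal := by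
  simpa using ENNReal.toReal_mono hp hp1.out

lemma Lp_integrable_norm_rpow (hp : p ≠ ∞) (F : Lp ℂ p μ) :
    Integrable (fun x => ‖F x‖ ^ p.toReal) μ :=
  (Lp.memLp F).integrable_norm_rpow (zero_lt_one.trans_le hp1.out).ne' hp

lemma Lp_norm_rpow_eq_integral (hp : p ≠ ∞) (F : Lp ℂ p μ) :
    ‖F‖ ^ p.toReal = ∫ x, ‖F x‖ ^ p.toReal ∂μ := by
  have h0 : 0 ≤ ∫ x, ‖F x‖ ^ p.toReal ∂μ := integral_nonneg fun x => by positivity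
  rw [Lp.norm_def, (Lp.memLp F).eLpNorm_eq_integral_rpow_norm (zero_lt_one.trans_le hp1.out).ne' hp,
    ENNReal.toReal_ofReal (by positivity), ← Real.rpow_mul h0,
    inv_mul_cancel₀ (by linarith [one_le_toReal_exponent p hp]), Real.rpow_one]

lemma integral_norm_rpow_le_of_norm_le (hp : p ≠ ∞) {F G : Lp ℂ p μ} (h : ‖F‖ ≤ ‖G‖) :
    ∫ x, ‖F x‖ ^ p.toReal ∂μ ≤ ∫ x, ‖G x‖ ^ p.toReal ∂μ := by
  rw [← Lp_norm_rpow_eq_integral hp, ← Lp_norm_rpow_eq_integral hp]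
  gcongr

lemma Lp_tendsto_of_dominated (hp : p ≠ ∞) {U : ℕ → Lp ℂ p μ} {F : Lp ℂ p μ} {G : X → ℝ}
    (hG : MemLp G p μ) (hb : ∀ n, ∀ᵐ x ∂μ, ‖U n x‖ ≤ G x)
    (h : ∀ᵐ x ∂μ, Tendsto (fun n => U n x) atTop (𝓝 (F x))) : Tendsto U atTop (𝓝 F) := by
  have hP := one_le_toReal_exponent p hp
  have key : Tendsto (fun n => ∫ x, ‖(U n - F) x‖ ^ p.toReal ∂μ) atTop
      (𝓝 (∫ _, (0 : ℝ) ∂μ)) := by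
    refine tendsto_integral_of_dominated_convergence
      (fun x => ‖G x + ‖F x‖‖ ^ p.toReal) (fun n => (Lp_integrable_norm_rpow hp _).1) ?_ ?_ ?_
    · exact (hG.add (Lp.memLp F).norm).integrable_norm_rpow (zero_lt_one.trans_le hp1.out).ne' hp
    · intro n
      filter_upwards [Lp.coeFn_sub (U n) F, hb n] with x h1 h2
      rw [Real.norm_of_nonneg (by positivity), h1]
      refine Real.rpow_le_rpow (norm_nonneg _) ?_ (by linarith)
      refine le_trans ?_ (le_abs_self _)
      exact (norm_sub_le _ _).trans (by linarith)
    · filter_upwards [ae_all_iff.2 fun n => Lp.coeFn_sub (U n) F, h] with x h1 h2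
      simp_rw [h1, Pi.sub_apply]
      have := ((h2.sub_const (F x)).norm).rpow_const (p := p.toReal) (Or.inr (by linarith))
      simpa [Real.zero_rpow (by linarith : p.toReal ≠ 0)] using this
  rw [tendsto_iff_norm_sub_tendsto_zero]
  simp_rw [← Lp_norm_rpow_eq_integral hp] at key
  have := key.rpow_const (p := p.toReal⁻¹) (Or.inr (by positivity))
  simp_rw [← Real.rpow_mul (norm_nonneg _),
    mul_inv_cancel₀ (by linarith : p.toReal ≠ 0), Real.rpow_one] at this
  simpa [Real.zero_rpow (by positivity : p.toReal⁻¹ ≠ 0)] using this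

/-- The functions that represent a fixed point of `e`. If `e` is a projection, these are the
representatives of the elements of its range. -/
def fixedFunctions (e : Lp ℂ p μ →L[ℂ] Lp ℂ p μ) : Submodule ℂ (X → ℂ) where
  carrier := {f | ∃ F : Lp ℂ p μ, e F = F ∧ F =ᵐ[μ] f}
  add_mem' := by
    rintro f g ⟨F, hF, hf⟩ ⟨G, hG, hg⟩
    exact ⟨F + G, by rw [map_add, hF, hG], (Lp.coeFn_add F G).trans (hf.add hg)⟩
  zero_mem' := ⟨0, by simp, Lp.coeFn_zero _ _ _⟩
  smul_mem' := by
    rintro c f ⟨F, hF, hf⟩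
    exact ⟨c • F, by rw [map_smul, hF], (Lp.coeFn_smul c F).trans (hf.const_smul c)⟩

lemma coeFn_mem_fixedFunctions {e : Lp ℂ p μ →L[ℂ] Lp ℂ p μ} {F : Lp ℂ p μ} (hF : e F = F) :
    (F : X → ℂ) ∈ fixedFunctions e := ⟨F, hF, .rfl⟩

lemma isDominatedClosed_fixedFunctions (hp : p ≠ ∞) (e : Lp ℂ p μ →L[ℂ] Lp ℂ p μ) :
    IsDominatedClosed μ p.toReal (fixedFunctions e) where
  memLp := by
    rintro f ⟨F, -, hf⟩
    rw [ENNReal.ofReal_toReal hp]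
    exact (memLp_congr_ae hf).1 (Lp.memLp F)
  closed := by
    intro u f G hu hG hb h
    rw [ENNReal.ofReal_toReal hp] at hG
    choose U hU hUu using hu
    have hfm : MemLp f p μ := by
      refine hG.mono' (aestronglyMeasurable_of_tendsto_ae atTop (f := u)
        (fun n => (Lp.aestronglyMeasurable (U n)).congr (hUu n)) h) ?_
      filter_upwards [ae_all_iff.2 hb, h] with x h1 h2
      exact le_of_tendsto' h2.norm h1
    have hlim : Tendsto U atTop (𝓝 (hfm.toLp f)) := by
      refine Lp_tendsto_of_dominated hp hG (fun n => ?_) ?_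
      · filter_upwards [hb n, hUu n] with x h1 h2
        rwa [h2]
      · filter_upwards [ae_all_iff.2 hUu, h, hfm.coeFn_toLp] with x h1 h2 h3
        simpa [h1, h3] using h2
    refine ⟨hfm.toLp f, ?_, hfm.coeFn_toLp⟩
    refine tendsto_nhds_unique ((e.continuous.tendsto _).comp hlim) ?_
    simpa [Function.comp_def, hU] using hlim

end Lp

/-! ### The dual pair of a contractive projection -/

section Young

lemma rpow_mul_lt_of_ne {p : ℝ} (hp : 1 < p) {a b : ℝ} (ha : 0 ≤ a) (hb : 0 ≤ b) (hab : b ≠ a) :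
    b * a ^ (p - 1) < b ^ p / p + (1 - 1 / p) * a ^ p := by
  have hp0 : 0 < p := by linarith
  rcases ha.eq_or_lt with rfl | ha'
  · rw [Real.zero_rpow (by linarith), Real.zero_rpow (by linarith)]
    have : 0 < b := lt_of_le_of_ne hb hab.symm
    simp; positivity
  · have h := one_add_mul_self_lt_rpow_one_add (s := b / a - 1)
      (by have : 0 ≤ b / a := by positivity
          linarith)
      (by rw [Ne, sub_eq_zero, div_eq_one_iff_eq ha'.ne']; exact hab) hp
    rw [add_sub_cancel, Real.div_rpow hb ha, lt_div_iff₀ (by positivity)] at h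
    have e : a ^ p = a ^ (p - 1) * a := by
      rw [← Real.rpow_add_one ha'.ne']; congr 1; ring
    rw [e] at h ⊢
    have h2 : (1 + p * (b / a - 1)) * (a ^ (p - 1) * a) =
        a ^ (p - 1) * a + p * (a ^ (p - 1) * (b - a)) := by field_simp
    rw [h2] at h
    have h3 : a ^ (p - 1) * (b - a) < (b ^ p - a ^ (p - 1) * a) / p := by
      rw [lt_div_iff₀ hp0]; linarith
    have h4 : (b ^ p - a ^ (p - 1) * a) / p = b ^ p / p - 1 / p * (a ^ (p - 1) * a) := by
      field_simp
    linarith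

lemma re_mul_conj_dualityMap_le_norm {p : ℝ} (hp : 1 < p) (z w : ℂ) :
    (w * conj (dualityMap p z)).re ≤ ‖w‖ * ‖z‖ ^ (p - 1) := by
  refine (Complex.re_le_norm _).trans (le_of_eq ?_)
  rw [norm_mul, RCLike.norm_conj, norm_dualityMap hp]

/-- Young's inequality, in the form that makes the duality map the gradient of `|z|^p / p`. -/
lemma re_mul_conj_dualityMap_le {p : ℝ} (hp : 1 < p) (z w : ℂ) :
    (w * conj (dualityMap p z)).re ≤ ‖w‖ ^ p / p + (1 - 1 / p) * ‖z‖ ^ p := by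
  refine (re_mul_conj_dualityMap_le_norm hp z w).trans ?_
  rcases eq_or_ne ‖w‖ ‖z‖ with h | h
  · rw [h, mul_comm, ← Real.rpow_add_one' (norm_nonneg _) (by linarith)]
    apply le_of_eq
    rw [show p - 1 + 1 = p by ring]; ring
  · exact (rpow_mul_lt_of_ne hp (norm_nonneg _) (norm_nonneg _) h).le

lemma mul_conj_dualityMap_self {p : ℝ} (hp : 1 < p) (z : ℂ) :
    z * conj (dualityMap p z) = ((‖z‖ ^ p : ℝ) : ℂ) := by
  rcases eq_or_ne z 0 with rfl | hz
  · simp [Real.zero_rpow (by linarith : p ≠ 0)]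
  have hz' : 0 < ‖z‖ := norm_pos_iff.2 hz
  rw [dualityMap, map_mul, Complex.conj_ofReal, mul_left_comm, Complex.mul_conj,
    Complex.normSq_eq_norm_sq, ← Complex.ofReal_mul, ← Real.rpow_two, ← Real.rpow_add hz']
  congr 2; ring

lemma eq_of_re_mul_conj_dualityMap_eq {p : ℝ} (hp : 1 < p) {z w : ℂ}
    (h : (w * conj (dualityMap p z)).re = ‖w‖ ^ p / p + (1 - 1 / p) * ‖z‖ ^ p) : w = z := by
  have hnorm : ‖w‖ = ‖z‖ := by
    by_contra hne
    exact absurd (h.symm.le.trans (re_mul_conj_dualityMap_le_norm hp z w))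
      (rpow_mul_lt_of_ne hp (norm_nonneg _) (norm_nonneg _) hne).not_ge
  rcases eq_or_ne z 0 with rfl | hz
  · simpa using hnorm
  have hz' : 0 < ‖z‖ := norm_pos_iff.2 hz
  have h1 : (w * conj (dualityMap p z)).re = ‖z‖ ^ (p - 2) * (w * conj z).re := by
    rw [dualityMap, map_mul, Complex.conj_ofReal, mul_left_comm, Complex.re_ofReal_mul]
  have h2 : ‖z‖ ^ p = ‖z‖ ^ (p - 2) * ‖z‖ ^ 2 := by
    rw [← Real.rpow_two, ← Real.rpow_add hz']; congr 1; ring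
  have h3 : (w * conj z).re = ‖z‖ ^ 2 := by
    have h4 : ‖z‖ ^ (p - 2) * (w * conj z).re = ‖z‖ ^ (p - 2) * ‖z‖ ^ 2 := by
      rw [← h1, h, hnorm, ← h2]; ring
    exact mul_left_cancel₀ (by positivity) h4
  have h5 : ‖w - z‖ ^ 2 = 0 := by
    rw [← Complex.normSq_eq_norm_sq, Complex.normSq_sub, Complex.normSq_eq_norm_sq,
      Complex.normSq_eq_norm_sq, h3, hnorm]
    ring
  exact sub_eq_zero.1 (norm_eq_zero.1 (pow_eq_zero_iff two_ne_zero |>.1 h5))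

end Young

section ContractiveProjection

variable {X : Type*} [MeasurableSpace X] {μ : Measure X} {p : ℝ≥0∞} {q : ℝ}

lemma memLp_coeFn_toReal (hp : p ≠ ∞) (F : Lp ℂ p μ) : MemLp F (ENNReal.ofReal p.toReal) μ := by
  rw [ENNReal.ofReal_toReal hp]; exact Lp.memLp F

lemma Lp_integrable_mul_conj (hp : p ≠ ∞) (hq : p.toReal.HolderConjugate q) (K : Lp ℂ p μ)
    {w : X → ℂ} (hw : MemLp w (ENNReal.ofReal q) μ) :
    Integrable (fun x => K x * conj (w x)) μ := by
  have := hq.ennrealOfReal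
  exact (memLp_coeFn_toReal hp K).integrable_mul hw.star

variable [hp1 : Fact (1 ≤ p)] {e : Lp ℂ p μ →L[ℂ] Lp ℂ p μ}

/-- The annihilator of the kernel of `e` in `L^q`, with respect to the sesquilinear pairing of `L^p`
and `L^q`. For a projection `e`, this is the range of the adjoint of `e`. -/
def kerAnnihilator (hp : p ≠ ∞) (hq : p.toReal.HolderConjugate q)
    (e : Lp ℂ p μ →L[ℂ] Lp ℂ p μ) : Submodule ℂ (X → ℂ) where
  carrier := {w | MemLp w (ENNReal.ofReal q) μ ∧
    ∀ K : Lp ℂ p μ, e K = 0 → ∫ x, K x * conj (w x) ∂μ = 0}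
  add_mem' := by
    rintro w w' ⟨hw, h⟩ ⟨hw', h'⟩
    refine ⟨hw.add hw', fun K hK => ?_⟩
    have := integral_add (Lp_integrable_mul_conj hp hq K hw) (Lp_integrable_mul_conj hp hq K hw')
    simpa [mul_add, h K hK, h' K hK] using this
  zero_mem' := ⟨MemLp.zero, by simp⟩
  smul_mem' := by
    rintro c w ⟨hw, h⟩
    refine ⟨hw.const_smul c, fun K hK => ?_⟩
    simp only [Pi.smul_apply, smul_eq_mul, map_mul, mul_left_comm _ (conj c)]
    rw [integral_const_mul, h K hK, mul_zero]

lemma isDominatedClosed_kerAnnihilator (hp : p ≠ ∞) (hq : p.toReal.HolderConjugate q)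
    (e : Lp ℂ p μ →L[ℂ] Lp ℂ p μ) : IsDominatedClosed μ q (kerAnnihilator hp hq e) where
  memLp w hw := hw.1
  closed := by
    intro u f G hu hG hb h
    have hfm : MemLp f (ENNReal.ofReal q) μ := by
      refine hG.mono' (aestronglyMeasurable_of_tendsto_ae atTop (f := u) (fun n => (hu n).1.1) h) ?_
      filter_upwards [ae_all_iff.2 hb, h] with x h1 h2
      exact le_of_tendsto' h2.norm h1
    refine ⟨hfm, fun K hK => ?_⟩
    have key : Tendsto (fun n => ∫ x, K x * conj (u n x) ∂μ) atTop
        (𝓝 (∫ x, K x * conj (f x) ∂μ)) := by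
      refine tendsto_integral_of_dominated_convergence (fun x => ‖K x‖ * G x)
        (fun n => (Lp_integrable_mul_conj hp hq K (hu n).1).1) ?_ (fun n => ?_) ?_
      · have := hq.ennrealOfReal
        exact (memLp_coeFn_toReal hp K).norm.integrable_mul hG
      · filter_upwards [hb n] with x hx
        rw [norm_mul, RCLike.norm_conj]
        gcongr
      · filter_upwards [h] with x hx
        exact ((Complex.continuous_conj.tendsto _).comp hx).const_mul _
    refine tendsto_nhds_unique key ?_
    simp_rw [fun n => (hu n).2 K hK]
    exact tendsto_const_nhds

/-- A fixed point of a contraction `e` has minimal norm in its translate by the kernel of `e`; the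
first order condition for this minimum. -/
lemma integral_re_nonneg_of_fixed (hp : p ≠ ∞) (hq : p.toReal.HolderConjugate q) (he : ‖e‖ ≤ 1)
    {F K : Lp ℂ p μ} (hF : e F = F) (hK : e K = 0) :
    0 ≤ ∫ x, (K x * conj (dualityMap p.toReal (F x))).re ∂μ := by
  have hP := hq.lt
  set P := p.toReal with hPdef
  let t : ℕ → ℝ := fun n => 1 / ((n : ℝ) + 1)
  have ht0 : ∀ n, 0 < t n := fun n => by positivity
  have ht1 : ∀ n, t n ≤ 1 := fun n => by
    rw [div_le_one (by positivity)]; linarith [(Nat.cast_nonneg n : (0 : ℝ) ≤ n)]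
  have hmem : ∀ n, MemLp (fun x => F x + t n * K x) (ENNReal.ofReal P) μ := fun n =>
    (memLp_coeFn_toReal hp F).add ((memLp_coeFn_toReal hp K).const_mul _)
  have hint : ∀ n, Integrable
      (fun x => (K x * conj (dualityMap P (F x + t n * K x))).re) μ := fun n =>
    (Lp_integrable_mul_conj hp hq K ((hmem n).dualityMap hq)).re
  have hpos : ∀ n, 0 ≤ ∫ x, (K x * conj (dualityMap P (F x + t n * K x))).re ∂μ := by
    intro n
    have hle : ‖F‖ ≤ ‖F + (t n : ℂ) • K‖ := by
      have := e.le_of_opNorm_le he (F + (t n : ℂ) • K)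
      simpa [hF, hK] using this
    have h1 := integral_norm_rpow_le_of_norm_le hp hle
    have h2 : ∫ x, (‖(F + (t n : ℂ) • K) x‖ ^ P - ‖F x‖ ^ P) ∂μ ≤
        ∫ x, P * (t n * (K x * conj (dualityMap P (F x + t n * K x))).re) ∂μ := by
      refine integral_mono_ae ((Lp_integrable_norm_rpow hp _).sub (Lp_integrable_norm_rpow hp _))
        (((hint n).const_mul _).const_mul _) ?_
      filter_upwards [Lp.coeFn_add F ((t n : ℂ) • K), Lp.coeFn_smul (t n : ℂ) K] with x hx1 hx2
      rw [hx1, Pi.add_apply, hx2, Pi.smul_apply, smul_eq_mul]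
      set z := F x + t n * K x with hz
      have h3 := re_mul_conj_dualityMap_le hP z (F x)
      have h4 : (z * conj (dualityMap P z)).re = ‖z‖ ^ P := by
        rw [mul_conj_dualityMap_self hP, Complex.ofReal_re]
      have h5 : t n * (K x * conj (dualityMap P z)).re =
          (z * conj (dualityMap P z)).re - (F x * conj (dualityMap P z)).re := by
        rw [← Complex.re_ofReal_mul, ← Complex.sub_re]; congr 1; rw [hz]; ring
      rw [h5, h4]
      have h6 : P * (‖F x‖ ^ P / P + (1 - 1 / P) * ‖z‖ ^ P) =
          ‖F x‖ ^ P + (P - 1) * ‖z‖ ^ P := by field_simp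
      nlinarith [mul_le_mul_of_nonneg_left h3 (by linarith : 0 ≤ P)]
    rw [integral_sub (Lp_integrable_norm_rpow hp _) (Lp_integrable_norm_rpow hp _),
      integral_const_mul, integral_const_mul] at h2
    have h3 : 0 ≤ P * (t n * ∫ x, (K x * conj (dualityMap P (F x + t n * K x))).re ∂μ) := by
      linarith
    have h4 := (mul_nonneg_iff_of_pos_left (by linarith : 0 < P)).1 h3
    exact (mul_nonneg_iff_of_pos_left (ht0 n)).1 h4
  have hFK : MemLp (fun x => ‖F x‖ + ‖K x‖) (ENNReal.ofReal P) μ :=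
    (memLp_coeFn_toReal hp F).norm.add (memLp_coeFn_toReal hp K).norm
  have hlim : Tendsto (fun n => ∫ x, (K x * conj (dualityMap P (F x + t n * K x))).re ∂μ) atTop
      (𝓝 (∫ x, (K x * conj (dualityMap P (F x))).re ∂μ)) := by
    refine tendsto_integral_of_dominated_convergence
      (fun x => ‖K x‖ * ‖‖F x‖ + ‖K x‖‖ ^ (P - 1)) (fun n => (hint n).1) ?_ (fun n => ?_) ?_
    · have := hq.ennrealOfReal
      exact (memLp_coeFn_toReal hp K).norm.integrable_mul (hFK.norm_rpow_sub_one hq)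
    · refine .of_forall fun x => ?_
      refine (Complex.abs_re_le_norm _).trans ?_
      rw [norm_mul, RCLike.norm_conj, norm_dualityMap hP]
      gcongr
      refine le_trans ?_ (le_abs_self _)
      refine (norm_add_le _ _).trans ?_
      rw [norm_mul, Complex.norm_real, Real.norm_of_nonneg (ht0 n).le]
      have := mul_le_of_le_one_left (norm_nonneg (K x)) (ht1 n)
      linarith
    · refine .of_forall fun x => ?_
      have h1 : Tendsto (fun n => F x + t n * K x) atTop (𝓝 (F x)) := by
        have := ((Complex.continuous_ofReal.tendsto 0).comp
          (tendsto_one_div_add_atTop_nhds_zero_nat (𝕜 := ℝ))).mul_const (K x)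
        simpa [t] using this.const_add (F x)
      have hc : Continuous fun z => (K x * conj (dualityMap P z)).re :=
        Complex.continuous_re.comp (continuous_const.mul
          (Complex.continuous_conj.comp (continuous_dualityMap hP)))
      exact (hc.tendsto _).comp h1
  exact ge_of_tendsto' hlim hpos

lemma dualityMap_mem_kerAnnihilator (hp : p ≠ ∞) (hq : p.toReal.HolderConjugate q) (he : ‖e‖ ≤ 1)
    {F : Lp ℂ p μ} (hF : e F = F) :
    (fun x => dualityMap p.toReal (F x)) ∈ kerAnnihilator hp hq e := by
  have hJ := (memLp_coeFn_toReal hp F).dualityMap hq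
  refine ⟨hJ, fun K hK => ?_⟩
  have key : ∀ c : ℂ, 0 ≤ (c * ∫ x, K x * conj (dualityMap p.toReal (F x)) ∂μ).re := by
    intro c
    have h := integral_re_nonneg_of_fixed hp hq he hF (K := c • K) (by simp [hK])
    have h2 : ∫ x, ((c • K) x * conj (dualityMap p.toReal (F x))).re ∂μ =
        (c * ∫ x, K x * conj (dualityMap p.toReal (F x)) ∂μ).re := by
      rw [← integral_const_mul]
      have h3 := (integral_re ((Lp_integrable_mul_conj hp hq K hJ).const_mul c))
      refine Eq.trans (integral_congr_ae ?_) h3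
      filter_upwards [Lp.coeFn_smul c K] with x hx
      simp only [hx, Pi.smul_apply, smul_eq_mul, mul_assoc]
      rfl
    rwa [h2] at h
  set I := ∫ x, K x * conj (dualityMap p.toReal (F x)) ∂μ
  have h1 := key 1
  have h2 := key (-1)
  have h3 := key Complex.I
  have h4 := key (-Complex.I)
  apply Complex.ext <;> simp at * <;> linarith

lemma mem_fixedFunctions_of_dualityMap_mem (hp : p ≠ ∞) (hq : p.toReal.HolderConjugate q)
    (he : ‖e‖ ≤ 1) (hee : ∀ F, e (e F) = e F) {f : X → ℂ}
    (hf : (fun x => dualityMap p.toReal (f x)) ∈ kerAnnihilator hp hq e) :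
    f ∈ fixedFunctions e := by
  have hP := hq.lt
  set P := p.toReal with hPdef
  have hfm : MemLp f (ENNReal.ofReal P) μ := by
    have := hf.1.dualityMap hq.symm
    simpa only [dualityMap_dualityMap hq] using this
  have hfm' : MemLp f p μ := by rwa [ENNReal.ofReal_toReal hp] at hfm
  set F := hfm'.toLp f with hFdef
  have hFf : F =ᵐ[μ] f := hfm'.coeFn_toLp
  refine ⟨F, ?_, hFf⟩
  have hJ : MemLp (fun x => dualityMap P (f x)) (ENNReal.ofReal q) μ := hf.1
  have h0 : ∫ x, (F x * conj (dualityMap P (f x)) - (e F) x * conj (dualityMap P (f x))) ∂μ = 0 := by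
    rw [← hf.2 (F - e F) (by rw [map_sub, hee, sub_self])]
    refine integral_congr_ae ?_
    filter_upwards [Lp.coeFn_sub F (e F)] with x hx
    rw [hx, Pi.sub_apply]; ring
  rw [integral_sub (Lp_integrable_mul_conj hp hq _ hJ) (Lp_integrable_mul_conj hp hq _ hJ),
    sub_eq_zero] at h0
  have h1 : ∫ x, F x * conj (dualityMap P (f x)) ∂μ = ((∫ x, ‖F x‖ ^ P ∂μ : ℝ) : ℂ) := by
    rw [← integral_complex_ofReal]
    refine integral_congr_ae ?_
    filter_upwards [hFf] with x hx
    rw [← hx, mul_conj_dualityMap_self hP]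
  have hre : ∫ x, ((e F) x * conj (dualityMap P (f x))).re ∂μ = ∫ x, ‖F x‖ ^ P ∂μ := by
    have h3 := integral_re (Lp_integrable_mul_conj hp hq (e F) hJ)
    refine h3.trans ?_
    rw [← h0, h1]; exact Complex.ofReal_re _
  have hle : ∫ x, ‖(e F) x‖ ^ P ∂μ ≤ ∫ x, ‖F x‖ ^ P ∂μ :=
    integral_norm_rpow_le_of_norm_le hp (by simpa using e.le_of_opNorm_le he F)
  -- The defect in Young's inequality is nonnegative and has nonpositive integral.
  let D : X → ℝ := fun x => (‖(e F) x‖ ^ P / P + (1 - 1 / P) * ‖F x‖ ^ P) -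
    ((e F) x * conj (dualityMap P (f x))).re
  have hi1 := (Lp_integrable_norm_rpow hp (e F)).div_const P
  have hi2 := (Lp_integrable_norm_rpow hp F).const_mul (1 - 1 / P)
  have hi3 : Integrable (fun x => ((e F) x * conj (dualityMap P (f x))).re) μ :=
    (Lp_integrable_mul_conj hp hq (e F) hJ).re
  have hD0 : 0 ≤ᵐ[μ] D := by
    filter_upwards [hFf] with x hx
    have := re_mul_conj_dualityMap_le hP (f x) ((e F) x)
    simp only [D, hx, Pi.zero_apply]; linarith
  have hDi : Integrable D μ := (hi1.add hi2).sub hi3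
  have hDint : ∫ x, D x ∂μ ≤ 0 := by
    have e1 : ∫ x, D x ∂μ = (∫ x, ‖(e F) x‖ ^ P ∂μ) / P + (1 - 1 / P) * ∫ x, ‖F x‖ ^ P ∂μ -
        ∫ x, ‖F x‖ ^ P ∂μ := by
      rw [← hre, ← integral_div, hre, ← integral_const_mul]
      refine (integral_sub (hi1.add hi2) hi3).trans ?_
      rw [hre]
      congr 1
      exact integral_add hi1 hi2
    rw [e1]
    have h5 : (∫ x, ‖(e F) x‖ ^ P ∂μ) / P ≤ (∫ x, ‖F x‖ ^ P ∂μ) / P := by gcongr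
    have h6 : (1 - 1 / P) * ∫ x, ‖F x‖ ^ P ∂μ = (∫ x, ‖F x‖ ^ P ∂μ) -
      (∫ x, ‖F x‖ ^ P ∂μ) / P := by ring
    linarith
  have hDz : D =ᵐ[μ] 0 := (integral_eq_zero_iff_of_nonneg_ae hD0 hDi).1
    (le_antisymm hDint (integral_nonneg_of_ae hD0))
  apply Lp.ext
  filter_upwards [hDz, hFf] with x h1 h2
  simp only [D, Pi.zero_apply, h2] at h1
  rw [h2]
  exact eq_of_re_mul_conj_dualityMap_eq hP (by linarith)

/-- The range of a contractive projection on `L^p`, `1 < p < ∞`, corresponds under the duality map to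
the annihilator of the kernel: `⊆` is the smoothness of the norm of `L^p`, and `⊇` is its strict
convexity. -/
theorem isDualPair_of_contractive_projection (hp : p ≠ ∞) (hq : p.toReal.HolderConjugate q)
    (he : ‖e‖ ≤ 1) (hee : ∀ F, e (e F) = e F) :
    IsDualPair μ p.toReal q (fixedFunctions e) (kerAnnihilator hp hq e) where
  exponents := hq
  left := isDominatedClosed_fixedFunctions hp e
  right := isDominatedClosed_kerAnnihilator hp hq e
  mem_iff f := by
    refine ⟨?_, mem_fixedFunctions_of_dualityMap_mem hp hq he hee⟩
    rintro ⟨F, hF, hFf⟩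
    refine (isDominatedClosed_kerAnnihilator hp hq e).congr
      (dualityMap_mem_kerAnnihilator hp hq he hF) ?_
    filter_upwards [hFf] with x hx
    rw [hx]

lemma isLocalizable_of_one_lt (hp : p ≠ ∞) (hp1' : 1 < p.toReal) (hp2 : p.toReal ≠ 2)
    (he : ‖e‖ ≤ 1) (hee : ∀ F, e (e F) = e F) : IsLocalizable (fixedFunctions e) := by
  have hq := Real.HolderConjugate.conjExponent hp1'
  have h := isDualPair_of_contractive_projection hp hq he hee
  rcases hp2.lt_or_gt with h2 | h2
  · refine h.symm.isLocalizable_right ?_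
    rw [Real.conjExponent, lt_div_iff₀ (by linarith)]
    linarith
  · exact h.isLocalizable_left h2

end ContractiveProjection

/-! ### Contractive projections on `L^1` -/

section LOne

variable {X : Type*} [MeasurableSpace X] {μ : Measure X} {e : Lp ℂ 1 μ →L[ℂ] Lp ℂ 1 μ}

lemma exists_Lp_coeFn_ae_eq {p : ℝ≥0∞} {f : X → ℂ} (hf : AEStronglyMeasurable f μ) {H : Lp ℂ p μ}
    (h : ∀ᵐ x ∂μ, ‖f x‖ ≤ ‖H x‖) : ∃ R : Lp ℂ p μ, R =ᵐ[μ] f :=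
  ⟨((Lp.memLp H).mono hf h).toLp f, MemLp.coeFn_toLp _⟩

lemma L1_ae_eq_of_norm_le {f g : Lp ℂ 1 μ} (h : ∀ᵐ x ∂μ, ‖f x‖ ≤ ‖g x‖) (hn : ‖g‖ ≤ ‖f‖) :
    ∀ᵐ x ∂μ, ‖f x‖ = ‖g x‖ := by
  rw [L1.norm_eq_integral_norm, L1.norm_eq_integral_norm] at hn
  have hi := (L1.integrable_coeFn g).norm.sub (L1.integrable_coeFn f).norm
  have h0 : 0 ≤ᵐ[μ] ((fun x => ‖g x‖) - fun x => ‖f x‖) := by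
    filter_upwards [h] with x hx
    simpa using hx
  have h1 : ∫ x, ((fun x => ‖g x‖) - fun x => ‖f x‖) x ∂μ ≤ 0 := by
    refine (integral_sub (L1.integrable_coeFn g).norm (L1.integrable_coeFn f).norm).trans_le ?_
    linarith
  have h2 := (integral_eq_zero_iff_of_nonneg_ae h0 hi).1 (le_antisymm h1 (integral_nonneg_of_ae h0))
  filter_upwards [h2] with x hx
  simp only [Pi.sub_apply, Pi.zero_apply] at hx
  linarith

/-- A contraction on `L^1` that fixes `F` maps the order interval between `0` and `F` into itself,
because the norm is additive on it. -/
lemma apply_mem_segment_of_fixed (he : ‖e‖ ≤ 1) {F H : Lp ℂ 1 μ} (hF : e F = F)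
    (hH : ∀ᵐ x ∂μ, ∃ c : ℝ, 0 ≤ c ∧ c ≤ 1 ∧ H x = c * F x) :
    ∀ᵐ x ∂μ, ∃ c : ℝ, 0 ≤ c ∧ (e H) x = c * F x := by
  have hsum : ‖H‖ + ‖F - H‖ = ‖F‖ := by
    rw [L1.norm_eq_integral_norm, L1.norm_eq_integral_norm, L1.norm_eq_integral_norm,
      ← integral_add (L1.integrable_coeFn _).norm (L1.integrable_coeFn _).norm]
    refine integral_congr_ae ?_
    filter_upwards [Lp.coeFn_sub F H, hH] with x h1 ⟨c, h0, hc1, hc⟩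
    rw [h1, Pi.sub_apply, hc, show F x - c * F x = ((1 - c : ℝ) : ℂ) * F x by push_cast; ring,
      norm_mul, norm_mul, Complex.norm_real, Complex.norm_real, Real.norm_of_nonneg h0,
      Real.norm_of_nonneg (by linarith)]
    ring
  have h1 : ‖e H‖ ≤ ‖H‖ := by simpa using e.le_of_opNorm_le he H
  have h2 : ‖F - e H‖ ≤ ‖F - H‖ := by simpa [hF] using e.le_of_opNorm_le he (F - H)
  have hint := (L1.integrable_coeFn (e H)).norm.add (L1.integrable_coeFn (F - e H)).norm
  have h3 : ∫ x, (‖(e H) x‖ + ‖(F - e H) x‖ - ‖F x‖) ∂μ ≤ 0 := by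
    refine (integral_sub hint (L1.integrable_coeFn F).norm).trans_le ?_
    have h4 : ∫ x, ((fun x => ‖(e H) x‖) + fun x => ‖(F - e H) x‖) x ∂μ = ‖e H‖ + ‖F - e H‖ := by
      rw [L1.norm_eq_integral_norm, L1.norm_eq_integral_norm]
      exact integral_add (L1.integrable_coeFn _).norm (L1.integrable_coeFn _).norm
    rw [h4, ← L1.norm_eq_integral_norm]
    linarith
  have h0 : 0 ≤ᵐ[μ] fun x => ‖(e H) x‖ + ‖(F - e H) x‖ - ‖F x‖ := by
    filter_upwards [Lp.coeFn_sub F (e H)] with x hx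
    rw [hx]
    have := norm_add_le ((e H) x) (F x - (e H) x)
    rw [add_sub_cancel] at this
    simpa using this
  have h5 := (integral_eq_zero_iff_of_nonneg_ae h0 (hint.sub (L1.integrable_coeFn F).norm)).1
    (le_antisymm h3 (integral_nonneg_of_ae h0))
  filter_upwards [h5, Lp.coeFn_sub F (e H)] with x hx hs
  rw [hs] at hx
  simp only [Pi.sub_apply, Pi.zero_apply] at hx
  have hray : SameRay ℝ ((e H) x) (F x - (e H) x) := by
    rw [sameRay_iff_norm_add, add_sub_cancel]; linarith
  rcases eq_or_ne (F x) 0 with hF0 | hF0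
  · refine ⟨0, le_rfl, ?_⟩
    rw [hF0] at hx ⊢
    have : ‖(e H) x‖ = 0 := by
      have := norm_nonneg (0 - (e H) x)
      have := norm_nonneg ((e H) x)
      simp at hx; simp [hx]
    simpa using this
  · have hray2 : SameRay ℝ ((e H) x) (F x) := by
      simpa using (SameRay.refl ((e H) x)).add_right hray
    obtain ⟨c, hc, hc2⟩ := hray2.exists_nonneg_right hF0
    exact ⟨c, hc, by simpa using hc2⟩

/-- The operator that a contraction on `L^1` with fixed point `F` induces on the multipliers of `F`
is positive. -/
lemma apply_nonneg_mul_of_fixed (he : ‖e‖ ≤ 1) {F H : Lp ℂ 1 μ} (hF : e F = F)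
    (hH : ∀ᵐ x ∂μ, ∃ c : ℝ, 0 ≤ c ∧ H x = c * F x) :
    ∀ᵐ x ∂μ, ∃ c : ℝ, 0 ≤ c ∧ (e H) x = c * F x := by
  -- Truncate the multiplier `H / F`, so that a scalar multiple of `H` lies between `0` and `F`.
  let S : ℕ → Set X := fun n => {x | ‖H x‖ ≤ (n + 1) * ‖F x‖}
  have hS : ∀ n, MeasurableSet (S n) := fun n =>
    measurableSet_le (Lp.stronglyMeasurable H).measurable.norm
      ((Lp.stronglyMeasurable F).measurable.norm.const_mul _)
  have hex : ∀ n, ∃ R : Lp ℂ 1 μ, R =ᵐ[μ] (S n).indicator H := fun n =>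
    exists_Lp_coeFn_ae_eq ((Lp.stronglyMeasurable H).indicator (hS n)).aestronglyMeasurable
      (.of_forall fun x => norm_indicator_le_norm_self _ _)
  choose U hU using hex
  have hpos : ∀ n, ∀ᵐ x ∂μ, ∃ c : ℝ, 0 ≤ c ∧ (e (U n)) x = c * F x := by
    intro n
    have h1 := apply_mem_segment_of_fixed he hF (H := ((n + 1 : ℂ)⁻¹) • U n) (by
      filter_upwards [Lp.coeFn_smul ((n + 1 : ℂ)⁻¹) (U n), hU n, hH] with x hx hx2 ⟨c, hc, hcx⟩
      rw [hx, Pi.smul_apply, hx2]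
      by_cases hxS : x ∈ S n
      · rw [Set.indicator_of_mem hxS]
        rcases eq_or_ne (F x) 0 with hF0 | hF0
        · exact ⟨0, le_rfl, zero_le_one, by simp [hcx, hF0]⟩
        have hF1 : 0 < ‖F x‖ := norm_pos_iff.2 hF0
        have hcn : c ≤ n + 1 := by
          have h2 : ‖H x‖ ≤ (n + 1) * ‖F x‖ := hxS
          rw [hcx, norm_mul, Complex.norm_real, Real.norm_of_nonneg hc] at h2
          exact le_of_mul_le_mul_right h2 hF1
        refine ⟨(n + 1 : ℝ)⁻¹ * c, by positivity, ?_, ?_⟩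
        · rw [inv_mul_le_iff₀ (by positivity)]; linarith
        · rw [hcx]; push_cast; simp [mul_assoc]
      · rw [Set.indicator_of_notMem hxS]
        exact ⟨0, le_rfl, zero_le_one, by simp⟩)
    rw [map_smul] at h1
    filter_upwards [h1, Lp.coeFn_smul ((n + 1 : ℂ)⁻¹) (e (U n))] with x ⟨c, hc, hcx⟩ hx
    refine ⟨(n + 1) * c, by positivity, ?_⟩
    rw [hx, Pi.smul_apply, smul_eq_mul, inv_mul_eq_iff_eq_mul₀ (by exact_mod_cast n.succ_ne_zero)]
      at hcx
    rw [hcx]; push_cast; ring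
  have hlim : Tendsto U atTop (𝓝 H) := by
    refine Lp_tendsto_of_dominated ENNReal.one_ne_top (Lp.memLp H).norm (fun n => ?_) ?_
    · filter_upwards [hU n] with x hx
      rw [hx]; exact norm_indicator_le_norm_self _ _
    · filter_upwards [ae_all_iff.2 hU, hH] with x hx ⟨c, hc, hcx⟩
      refine tendsto_const_nhds.congr' ?_
      filter_upwards [eventually_ge_atTop ⌈c⌉₊] with n hn
      rw [hx, Set.indicator_of_mem]
      change ‖H x‖ ≤ (n + 1) * ‖F x‖
      rw [hcx, norm_mul, Complex.norm_real, Real.norm_of_nonneg hc]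
      have : c ≤ n := (Nat.le_ceil c).trans (by exact_mod_cast hn)
      gcongr; linarith
  obtain ⟨ns, -, hns⟩ := (tendstoInMeasure_of_tendsto_Lp
    ((e.continuous.tendsto _).comp hlim)).exists_seq_tendsto_ae
  filter_upwards [hns, ae_all_iff.2 hpos] with x hx hx2
  rcases eq_or_ne (F x) 0 with hF0 | hF0
  · refine ⟨0, le_rfl, ?_⟩
    have : ∀ i, (e (U (ns i))) x = 0 := fun i => by
      obtain ⟨c, -, hc⟩ := hx2 (ns i)
      rw [hc, hF0, mul_zero]
    simp only [Function.comp, this] at hx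
    simpa using tendsto_nhds_unique hx tendsto_const_nhds
  · have h1 : ∀ i, ∃ c : ℝ, 0 ≤ c ∧ (e (U (ns i))) x / F x = c := fun i => by
      obtain ⟨c, hc, hcx⟩ := hx2 (ns i)
      exact ⟨c, hc, by rw [hcx, mul_div_cancel_right₀ _ hF0]⟩
    have h2 : IsClosed ((fun c : ℝ => (c : ℂ)) '' Set.Ici 0) :=
      Complex.isometry_ofReal.isClosedEmbedding.isClosedMap _ isClosed_Ici
    have h3 := h2.mem_of_tendsto (hx.div_const (F x)) (.of_forall fun i => by
      obtain ⟨c, hc, hcx⟩ := h1 i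
      exact ⟨c, hc, hcx.symm⟩)
    obtain ⟨c, hc, hcx⟩ := h3
    exact ⟨c, hc, by rw [eq_comm, div_eq_iff hF0] at hcx; exact hcx⟩

lemma exists_ofReal_mul {F H : Lp ℂ 1 μ} {c : X → ℝ} (hc : Measurable c)
    (h : ∀ᵐ x ∂μ, ‖c x * F x‖ ≤ ‖H x‖) : ∃ R : Lp ℂ 1 μ, R =ᵐ[μ] fun x => c x * F x :=
  exists_Lp_coeFn_ae_eq ((Complex.measurable_ofReal.comp hc).mul
    (Lp.stronglyMeasurable F).measurable).aestronglyMeasurable h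

lemma apply_real_mul_of_fixed (he : ‖e‖ ≤ 1) {F H : Lp ℂ 1 μ} (hF : e F = F) {c : X → ℝ}
    (hc : Measurable c) (hH : H =ᵐ[μ] fun x => c x * F x) :
    ∃ c' : X → ℝ, e H =ᵐ[μ] fun x => c' x * F x := by
  obtain ⟨R, hR⟩ := exists_ofReal_mul (F := F) (H := H) (c := fun x => |c x|) (by fun_prop) (by
    filter_upwards [hH] with x hx
    simp [hx])
  have h1 := apply_nonneg_mul_of_fixed he hF (H := R) (by
    filter_upwards [hR] with x hx
    exact ⟨_, abs_nonneg _, hx⟩)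
  have h2 := apply_nonneg_mul_of_fixed he hF (H := R - H) (by
    filter_upwards [hR, hH, Lp.coeFn_sub R H] with x hx hx2 hx3
    refine ⟨|c x| - c x, by linarith [le_abs_self (c x)], ?_⟩
    rw [hx3, Pi.sub_apply, hx, hx2]; push_cast; ring)
  rw [map_sub] at h2
  have h3 : ∀ᵐ x ∂μ, ∃ a : ℝ, (e H) x = a * F x := by
    filter_upwards [h1, h2, Lp.coeFn_sub (e R) (e H)] with x ⟨a, _, ha⟩ ⟨b, _, hb⟩ hx
    rw [hx, Pi.sub_apply, ha] at hb
    refine ⟨a - b, ?_⟩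
    push_cast; linear_combination -hb
  refine ⟨fun x => ((e H) x / F x).re, ?_⟩
  filter_upwards [h3] with x ⟨a, ha⟩
  rcases eq_or_ne (F x) 0 with hF0 | hF0
  · simp [ha, hF0]
  · rw [ha, mul_div_cancel_right₀ _ hF0, Complex.ofReal_re]

lemma exists_re_im_mul {F H : Lp ℂ 1 μ} (hH : ∀ᵐ x ∂μ, F x = 0 → H x = 0) :
    ∃ R I : Lp ℂ 1 μ, H = R + Complex.I • I ∧ (R =ᵐ[μ] fun x => ((H x / F x).re : ℂ) * F x) ∧
      (I =ᵐ[μ] fun x => ((H x / F x).im : ℂ) * F x) := by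
  have hm : Measurable fun x => H x / F x :=
    (Lp.stronglyMeasurable H).measurable.div (Lp.stronglyMeasurable F).measurable
  have hle : ∀ x, ‖H x / F x * F x‖ ≤ ‖H x‖ := fun x => by
    rcases eq_or_ne (F x) 0 with h | h
    · simp [h]
    · rw [div_mul_cancel₀ _ h]
  obtain ⟨R, hR⟩ := exists_ofReal_mul (F := F) (H := H) (c := fun x => (H x / F x).re)
    (Complex.measurable_re.comp hm) (.of_forall fun x => by
      refine le_trans ?_ (hle x)
      rw [norm_mul, norm_mul, Complex.norm_real]
      gcongr; exact Complex.abs_re_le_norm _)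
  obtain ⟨I, hI⟩ := exists_ofReal_mul (F := F) (H := H) (c := fun x => (H x / F x).im)
    (Complex.measurable_im.comp hm) (.of_forall fun x => by
      refine le_trans ?_ (hle x)
      rw [norm_mul, norm_mul, Complex.norm_real]
      gcongr; exact Complex.abs_im_le_norm _)
  refine ⟨R, I, ?_, hR, hI⟩
  apply Lp.ext
  filter_upwards [hR, hI, Lp.coeFn_add R (Complex.I • I), Lp.coeFn_smul Complex.I I, hH]
    with x h1 h2 h3 h4 h5
  rw [h3, Pi.add_apply, h4, Pi.smul_apply, h1, h2, smul_eq_mul]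
  rcases eq_or_ne (F x) 0 with h | h
  · simp [h, h5 h]
  · conv_lhs => rw [← div_mul_cancel₀ (H x) h, ← Complex.re_add_im (H x / F x)]
    ring

lemma apply_eq_zero_of_fixed (he : ‖e‖ ≤ 1) {F H : Lp ℂ 1 μ} (hF : e F = F)
    (hH : ∀ᵐ x ∂μ, F x = 0 → H x = 0) : ∀ᵐ x ∂μ, F x = 0 → (e H) x = 0 := by
  have hm : Measurable fun x => H x / F x :=
    (Lp.stronglyMeasurable H).measurable.div (Lp.stronglyMeasurable F).measurable
  obtain ⟨R, I, h, hR, hI⟩ := exists_re_im_mul hH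
  obtain ⟨a, ha⟩ := apply_real_mul_of_fixed he hF (Complex.measurable_re.comp hm) hR
  obtain ⟨b, hb⟩ := apply_real_mul_of_fixed he hF (Complex.measurable_im.comp hm) hI
  rw [h, map_add, map_smul]
  filter_upwards [ha, hb, Lp.coeFn_add (e R) (Complex.I • e I), Lp.coeFn_smul Complex.I (e I)]
    with x h1 h2 h3 h4 h5
  rw [h3, Pi.add_apply, h4, Pi.smul_apply, h1, h2, h5]
  simp

/-- The restriction of a fixed point `G` to the support of a fixed point `F` is fixed: off the
support of `F` only the other part of `G` contributes, so that this part already has the full norm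
there. -/
lemma restrict_fixed (he : ‖e‖ ≤ 1) {F G : Lp ℂ 1 μ} (hF : e F = F) (hG : e G = G) :
    ∃ R : Lp ℂ 1 μ, e R = R ∧ R =ᵐ[μ] {x | F x ≠ 0}.indicator G := by
  have hS : MeasurableSet {x | F x ≠ 0} :=
    (measurableSet_eq_fun (Lp.stronglyMeasurable F).measurable measurable_const).compl
  obtain ⟨R, hR⟩ : ∃ R : Lp ℂ 1 μ, R =ᵐ[μ] {x | F x ≠ 0}.indicator G :=
    exists_Lp_coeFn_ae_eq ((Lp.stronglyMeasurable G).indicator hS).aestronglyMeasurable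
      (.of_forall fun x => norm_indicator_le_norm_self _ _)
  refine ⟨R, ?_, hR⟩
  have h1 := apply_eq_zero_of_fixed he hF (H := R) (by
    filter_upwards [hR] with x hx hx0
    rw [hx, Set.indicator_of_notMem (by simpa using hx0)])
  have h2 : ‖e (G - R)‖ ≤ ‖G - R‖ := by simpa using e.le_of_opNorm_le he (G - R)
  have hsum : e (G - R) = G - e R := by rw [map_sub, hG]
  have h3 : ∀ᵐ x ∂μ, F x = 0 → (e (G - R)) x = (G - R) x := by
    rw [hsum]
    filter_upwards [h1, hR, Lp.coeFn_sub G R, Lp.coeFn_sub G (e R)] with x hx1 hx2 hx3 hx4 hx0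
    rw [hx3, hx4, Pi.sub_apply, Pi.sub_apply, hx1 hx0, hx2,
      Set.indicator_of_notMem (by simpa using hx0)]
  have h4 : ∀ᵐ x ∂μ, F x ≠ 0 → (G - R) x = 0 := by
    filter_upwards [hR, Lp.coeFn_sub G R] with x hx2 hx3 hx0
    rw [hx3, Pi.sub_apply, hx2, Set.indicator_of_mem (by exact hx0), sub_self]
  have h5 := L1_ae_eq_of_norm_le (f := G - R) (g := e (G - R)) (by
    filter_upwards [h3, h4] with x hx3 hx4
    by_cases hx0 : F x = 0
    · rw [hx3 hx0]
    · rw [hx4 hx0, norm_zero]; exact norm_nonneg _) h2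
  have h6 : e (G - R) = G - R := by
    apply Lp.ext
    filter_upwards [h3, h4, h5] with x hx3 hx4 hx5
    by_cases hx0 : F x = 0
    · exact hx3 hx0
    · rw [hx4 hx0, norm_zero, eq_comm, norm_eq_zero] at hx5
      rw [hx4 hx0, hx5]
  rw [hsum] at h6
  exact sub_right_injective h6

lemma restrict_im_fixed (he : ‖e‖ ≤ 1) {F G : Lp ℂ 1 μ} (hF : e F = F) (hG : e G = G) :
    ∃ R : Lp ℂ 1 μ, e R = R ∧ R =ᵐ[μ] {x | 0 < (G x * conj (F x)).im}.indicator F := by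
  obtain ⟨H, hH, hHG⟩ := restrict_fixed he hF hG
  have hm : Measurable fun x => H x / F x :=
    (Lp.stronglyMeasurable H).measurable.div (Lp.stronglyMeasurable F).measurable
  have hm_im : Measurable fun x => (H x / F x).im := Complex.measurable_im.comp hm
  obtain ⟨R, I, hRI, hR, hI⟩ := exists_re_im_mul (F := F) (H := H) (by
    filter_upwards [hHG] with x hx hx0
    rw [hx, Set.indicator_of_notMem (by simpa using hx0)])
  -- `I = Im (G / F) F` is fixed, because `e` maps real multiples of `F` to real multiples of `F`.
  have hIfix : e I = I := by
    obtain ⟨a, ha⟩ := apply_real_mul_of_fixed he hF (Complex.measurable_re.comp hm) hR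
    obtain ⟨b, hb⟩ := apply_real_mul_of_fixed he hF hm_im hI
    have h1 : e R + Complex.I • e I = R + Complex.I • I := by
      rw [← map_smul, ← map_add, ← hRI, hH]
    apply Lp.ext
    have h2 : (e R + Complex.I • e I : Lp ℂ 1 μ) =ᵐ[μ] (R + Complex.I • I : Lp ℂ 1 μ) := by rw [h1]
    filter_upwards [ha, hb, hR, hI, h2, Lp.coeFn_add (e R) (Complex.I • e I),
      Lp.coeFn_smul Complex.I (e I), Lp.coeFn_add R (Complex.I • I), Lp.coeFn_smul Complex.I I]
      with x x1 x2 x3 x4 x5 x6 x7 x8 x9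
    rw [x6, x8, Pi.add_apply, Pi.add_apply, x7, x9, Pi.smul_apply, Pi.smul_apply, x1, x2, x3, x4]
      at x5
    rw [x2, x4]
    rcases eq_or_ne (F x) 0 with h | h
    · simp [h]
    · have h6 : (a x + Complex.I * b x : ℂ) = (H x / F x).re + Complex.I * (H x / F x).im := by
        apply mul_right_cancel₀ h
        simp only [smul_eq_mul] at x5
        linear_combination x5
      have h7 := congrArg Complex.im h6
      simp at h7
      rw [h7, Complex.div_im]
  -- `J = |Im (G / F)| F` is fixed: positivity gives `|e J| ≥ |J|`, contractivity gives equality.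
  obtain ⟨J, hJ⟩ := exists_ofReal_mul (F := F) (H := I) (c := fun x => |(H x / F x).im|)
    hm_im.abs (by
      filter_upwards [hI] with x hx
      simp [hx])
  have hJfix : e J = J := by
    have h1 := apply_nonneg_mul_of_fixed he hF (H := J - I) (by
      filter_upwards [hJ, hI, Lp.coeFn_sub J I] with x x1 x2 x3
      refine ⟨|(H x / F x).im| - (H x / F x).im, by linarith [le_abs_self (H x / F x).im], ?_⟩
      rw [x3, Pi.sub_apply, x1, x2]; push_cast; ring)
    have h2 := apply_nonneg_mul_of_fixed he hF (H := J + I) (by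
      filter_upwards [hJ, hI, Lp.coeFn_add J I] with x x1 x2 x3
      refine ⟨|(H x / F x).im| + (H x / F x).im, by linarith [neg_abs_le (H x / F x).im], ?_⟩
      rw [x3, Pi.add_apply, x1, x2]; push_cast; ring)
    rw [map_sub, hIfix] at h1
    rw [map_add, hIfix] at h2
    have h3 : ∀ᵐ x ∂μ, ∃ c : ℝ, |(H x / F x).im| ≤ c ∧ (e J) x = c * F x := by
      filter_upwards [h1, h2, hI, Lp.coeFn_sub (e J) I, Lp.coeFn_add (e J) I]
        with x ⟨a, ha, hax⟩ ⟨b, hb, hbx⟩ x1 x2 x3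
      rw [x2, Pi.sub_apply, x1] at hax
      rw [x3, Pi.add_apply, x1] at hbx
      rcases eq_or_ne (F x) 0 with h | h
      · refine ⟨|(H x / F x).im|, le_rfl, ?_⟩
        simpa [h] using hax
      · have e1 : (e J) x = ((a + (H x / F x).im : ℝ) : ℂ) * F x := by
          push_cast; linear_combination hax
        have e2 : (e J) x = ((b - (H x / F x).im : ℝ) : ℂ) * F x := by
          push_cast; linear_combination hbx
        have e3 : a + (H x / F x).im = b - (H x / F x).im := by
          exact_mod_cast mul_right_cancel₀ h (e1.symm.trans e2)
        exact ⟨_, abs_le.2 ⟨by linarith, by linarith⟩, e1⟩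
    have h4 := L1_ae_eq_of_norm_le (f := J) (g := e J) (by
      filter_upwards [h3, hJ] with x ⟨c, hc, hcx⟩ x1
      rw [hcx, x1, norm_mul, norm_mul, Complex.norm_real, Complex.norm_real, Real.norm_eq_abs,
        Real.norm_eq_abs, abs_abs]
      exact mul_le_mul_of_nonneg_right (hc.trans (le_abs_self c)) (norm_nonneg _)) (by simpa using e.le_of_opNorm_le he J)
    apply Lp.ext
    filter_upwards [h3, hJ, h4] with x ⟨c, hc, hcx⟩ x1 x2
    rw [hcx, x1, norm_mul, norm_mul, Complex.norm_real, Complex.norm_real, Real.norm_eq_abs,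
        Real.norm_eq_abs, abs_abs] at x2
    rw [hcx, x1]
    rcases eq_or_ne (F x) 0 with h | h
    · simp [h]
    · have h5 := mul_right_cancel₀ (norm_ne_zero_iff.2 h) x2
      rw [abs_of_nonneg ((abs_nonneg _).trans hc)] at h5
      rw [h5]
  obtain ⟨T, hT, hTF⟩ := restrict_fixed he (F := J + I) (G := F) (by rw [map_add, hJfix, hIfix]) hF
  refine ⟨T, hT, hTF.trans ?_⟩
  filter_upwards [hJ, hI, hHG, Lp.coeFn_add J I] with x x1 x2 x3 x4
  have e1 : ((J + I : Lp ℂ 1 μ) x ≠ 0 ∧ F x ≠ 0) ↔ 0 < (G x * conj (F x)).im := by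
    rcases eq_or_ne (F x) 0 with h | h
    · simp [h]
    have h0 : (0 : ℝ) < Complex.normSq (F x) := Complex.normSq_pos.2 h
    have e2 : (G x * conj (F x)).im = (H x / F x).im * Complex.normSq (F x) := by
      rw [x3, Set.indicator_of_mem (by exact h), ← Complex.im_mul_ofReal, ← Complex.mul_conj,
        ← mul_assoc, div_mul_cancel₀ _ h]
    rw [x4, Pi.add_apply, x1, x2, e2, mul_pos_iff_of_pos_right h0, ← add_mul]
    simp only [ne_eq, mul_eq_zero, h, or_false, not_false_eq_true, and_true]
    norm_cast
    constructor
    · intro h5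
      by_contra h6
      exact h5 (by rw [abs_of_nonpos (not_lt.1 h6)]; ring)
    · intro h5
      rw [abs_of_pos h5]; linarith
  simp only [Set.indicator_apply, Set.mem_ofPred_eq, ← e1]
  by_cases h : F x = 0
  · simp [h]
  · simp [h]

lemma isLocalizable_one (he : ‖e‖ ≤ 1) : IsLocalizable (fixedFunctions e) where
  restrict := by
    rintro f ⟨F, hF, hf⟩ g ⟨G, hG, hg⟩
    obtain ⟨R, hR, h⟩ := restrict_fixed he hF hG
    refine ⟨R, hR, h.trans ?_⟩
    filter_upwards [hf, hg] with x h1 h2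
    simp only [Set.indicator_apply, Set.mem_ofPred_eq, h1, h2]
  restrict_im := by
    rintro f ⟨F, hF, hf⟩ g ⟨G, hG, hg⟩
    obtain ⟨R, hR, h⟩ := restrict_im_fixed he hF hG
    refine ⟨R, hR, h.trans ?_⟩
    filter_upwards [hf, hg] with x h1 h2
    simp only [Set.indicator_apply, Set.mem_ofPred_eq, h1, h2]

end LOne

/-- The range of a contractive projection on `L^p`, `p ≠ 2`, is localizable. -/
theorem isLocalizable_fixedFunctions {X : Type*} [MeasurableSpace X] {μ : Measure X} {p : ℝ≥0∞}
    [hp1 : Fact (1 ≤ p)] (hp : p ≠ ∞) (hp2 : p ≠ 2) {e : Lp ℂ p μ →L[ℂ] Lp ℂ p μ}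
    (he : ‖e‖ ≤ 1) (hee : ∀ F, e (e F) = e F) : IsLocalizable (fixedFunctions e) := by
  rcases (one_le_toReal_exponent p hp).eq_or_lt with h | h
  · have h1 : p = 1 := by rw [← ENNReal.ofReal_toReal hp, ← h, ENNReal.ofReal_one]
    subst h1
    exact isLocalizable_one he
  · refine isLocalizable_of_one_lt hp h (fun h2 => hp2 ?_) he hee
    rw [← ENNReal.ofReal_toReal hp, h2, ENNReal.ofReal_ofNat]

/-! ### Disjointness in `L^p` for `p ≠ 2` -/

section Clarkson

lemma norm_add_sub_sq (a b : ℂ) : ∃ c : ℝ, |c| ≤ ‖a‖ ^ 2 + ‖b‖ ^ 2 ∧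
    ‖a + b‖ ^ 2 = ‖a‖ ^ 2 + ‖b‖ ^ 2 + c ∧ ‖a - b‖ ^ 2 = ‖a‖ ^ 2 + ‖b‖ ^ 2 - c := by
  have h1 : ‖a + b‖ ^ 2 = ‖a‖ ^ 2 + ‖b‖ ^ 2 + 2 * (a * conj b).re := by
    simp only [← Complex.normSq_eq_norm_sq, Complex.normSq_add]
  have h2 : ‖a - b‖ ^ 2 = ‖a‖ ^ 2 + ‖b‖ ^ 2 - 2 * (a * conj b).re := by
    simp only [← Complex.normSq_eq_norm_sq, Complex.normSq_sub]
  refine ⟨2 * (a * conj b).re, abs_le.2 ⟨?_, ?_⟩, h1, h2⟩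
  · nlinarith [sq_nonneg ‖a + b‖]
  · nlinarith [sq_nonneg ‖a - b‖]

lemma norm_rpow_eq_sq_rpow (r : ℝ) (z : ℂ) : ‖z‖ ^ r = (‖z‖ ^ 2) ^ (r / 2) := by
  rw [← Real.rpow_two, ← Real.rpow_mul (norm_nonneg _)]
  congr 1; ring

lemma two_mul_lt_norm_add_rpow {r : ℝ} (hr : 2 < r) {a b : ℂ} (ha : a ≠ 0) (hb : b ≠ 0) :
    2 * (‖a‖ ^ r + ‖b‖ ^ r) < ‖a + b‖ ^ r + ‖a - b‖ ^ r := by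
  obtain ⟨c, hc, h1, h2⟩ := norm_add_sub_sq a b
  simp only [norm_rpow_eq_sq_rpow r, h1, h2]
  have hA : 0 < ‖a‖ ^ 2 := by have := norm_pos_iff.2 ha; positivity
  have hB : 0 < ‖b‖ ^ 2 := by have := norm_pos_iff.2 hb; positivity
  generalize ‖a‖ ^ 2 = A at *
  generalize ‖b‖ ^ 2 = B at *
  obtain ⟨hc1, hc2⟩ := abs_le.1 hc
  have hconv := (convexOn_rpow (p := r / 2) (by linarith)).2
    (show A + B + c ∈ Set.Ici 0 by simp; linarith) (show A + B - c ∈ Set.Ici 0 by simp; linarith)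
    (show (0 : ℝ) ≤ 1 / 2 by norm_num) (show (0 : ℝ) ≤ 1 / 2 by norm_num) (by norm_num)
  simp only [smul_eq_mul] at hconv
  rw [show 1 / 2 * (A + B + c) + 1 / 2 * (A + B - c) = A + B by ring] at hconv
  have e : ∀ x : ℝ, 0 < x → x ^ (r / 2) = x ^ (r / 2 - 1) * x := fun x hx => by
    rw [← Real.rpow_add_one hx.ne']; congr 1; ring
  have h3 : A ^ (r / 2 - 1) < (A + B) ^ (r / 2 - 1) :=
    Real.rpow_lt_rpow hA.le (by linarith) (by linarith)
  have h4 : B ^ (r / 2 - 1) < (A + B) ^ (r / 2 - 1) :=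
    Real.rpow_lt_rpow hB.le (by linarith) (by linarith)
  have h5 : A ^ (r / 2) + B ^ (r / 2) < (A + B) ^ (r / 2) := by
    rw [e A hA, e B hB, e (A + B) (by linarith), mul_add]
    gcongr
  linarith

lemma norm_add_rpow_lt_two_mul {r : ℝ} (hr0 : 0 < r) (hr : r < 2) {a b : ℂ} (ha : a ≠ 0)
    (hb : b ≠ 0) : ‖a + b‖ ^ r + ‖a - b‖ ^ r < 2 * (‖a‖ ^ r + ‖b‖ ^ r) := by
  obtain ⟨c, hc, h1, h2⟩ := norm_add_sub_sq a b
  simp only [norm_rpow_eq_sq_rpow r, h1, h2]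
  have hA : 0 < ‖a‖ ^ 2 := by have := norm_pos_iff.2 ha; positivity
  have hB : 0 < ‖b‖ ^ 2 := by have := norm_pos_iff.2 hb; positivity
  generalize ‖a‖ ^ 2 = A at *
  generalize ‖b‖ ^ 2 = B at *
  obtain ⟨hc1, hc2⟩ := abs_le.1 hc
  have hconc := (Real.concaveOn_rpow (p := r / 2) (by linarith) (by linarith)).2
    (show A + B + c ∈ Set.Ici 0 by simp; linarith) (show A + B - c ∈ Set.Ici 0 by simp; linarith)
    (show (0 : ℝ) ≤ 1 / 2 by norm_num) (show (0 : ℝ) ≤ 1 / 2 by norm_num) (by norm_num)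
  simp only [smul_eq_mul] at hconc
  rw [show 1 / 2 * (A + B + c) + 1 / 2 * (A + B - c) = A + B by ring] at hconc
  have e : ∀ x : ℝ, 0 < x → x ^ (r / 2) = x ^ (r / 2 - 1) * x := fun x hx => by
    rw [← Real.rpow_add_one hx.ne']; congr 1; ring
  have h3 : (A + B) ^ (r / 2 - 1) < A ^ (r / 2 - 1) :=
    Real.rpow_lt_rpow_of_neg hA (by linarith) (by linarith)
  have h4 : (A + B) ^ (r / 2 - 1) < B ^ (r / 2 - 1) :=
    Real.rpow_lt_rpow_of_neg hB (by linarith) (by linarith)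
  have h5 : (A + B) ^ (r / 2) < A ^ (r / 2) + B ^ (r / 2) := by
    rw [e A hA, e B hB, e (A + B) (by linarith), mul_add]
    gcongr
  linarith

/-- Up to a global sign, the defect in the parallelogram identity for the exponent `r ≠ 2` is
nonnegative, and it vanishes only if `a` or `b` does. -/
lemma exists_sign_parallelogram {r : ℝ} (hr0 : 0 < r) (hr : r ≠ 2) : ∃ σ : ℝ, ∀ a b : ℂ,
    0 ≤ σ * (‖a + b‖ ^ r + ‖a - b‖ ^ r - 2 * (‖a‖ ^ r + ‖b‖ ^ r)) ∧
    (σ * (‖a + b‖ ^ r + ‖a - b‖ ^ r - 2 * (‖a‖ ^ r + ‖b‖ ^ r)) = 0 ↔ a * b = 0) := by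
  have h0 : ∀ a b : ℂ, a * b = 0 → ‖a + b‖ ^ r + ‖a - b‖ ^ r - 2 * (‖a‖ ^ r + ‖b‖ ^ r) = 0 := by
    intro a b hab
    rcases mul_eq_zero.1 hab with rfl | rfl
    · simp [Real.zero_rpow hr0.ne']; ring
    · simp [Real.zero_rpow hr0.ne']; ring
  rcases hr.lt_or_gt with h | h
  · refine ⟨-1, fun a b => ?_⟩
    by_cases hab : a * b = 0
    · simp [h0 a b hab, hab]
    · have := norm_add_rpow_lt_two_mul hr0 h (left_ne_zero_of_mul hab) (right_ne_zero_of_mul hab)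
      exact ⟨by linarith, ⟨fun h' => by linarith, fun h' => absurd h' hab⟩⟩
  · refine ⟨1, fun a b => ?_⟩
    by_cases hab : a * b = 0
    · simp [h0 a b hab, hab]
    · have := two_mul_lt_norm_add_rpow h (left_ne_zero_of_mul hab) (right_ne_zero_of_mul hab)
      exact ⟨by linarith, ⟨fun h' => by linarith, fun h' => absurd h' hab⟩⟩

variable {X : Type*} [MeasurableSpace X] {μ : Measure X} {p : ℝ≥0∞} [hp1 : Fact (1 ≤ p)]

/-- For `p ≠ 2`, disjointness of supports is a metric property of `L^p`. -/
lemma mul_ae_eq_zero_iff_norm (hp : p ≠ ∞) (hp2 : p ≠ 2) (F G : Lp ℂ p μ) :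
    (∀ᵐ x ∂μ, F x * G x = 0) ↔
      ‖F + G‖ ^ p.toReal + ‖F - G‖ ^ p.toReal = 2 * (‖F‖ ^ p.toReal + ‖G‖ ^ p.toReal) := by
  have hP := one_le_toReal_exponent p hp
  have hP2 : p.toReal ≠ 2 := fun h2 => hp2 (by
    rw [← ENNReal.ofReal_toReal hp, h2, ENNReal.ofReal_ofNat])
  obtain ⟨σ, hσ⟩ := exists_sign_parallelogram (by linarith) hP2
  have hσ0 : σ ≠ 0 := by
    rintro rfl
    simpa using (hσ 1 1).2
  have hi := fun H : Lp ℂ p μ => Lp_integrable_norm_rpow hp H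
  have hI1 : Integrable (fun x => ‖(F + G) x‖ ^ p.toReal + ‖(F - G) x‖ ^ p.toReal) μ :=
    (hi _).add (hi _)
  have hI2 : Integrable (fun x => 2 * (‖F x‖ ^ p.toReal + ‖G x‖ ^ p.toReal)) μ :=
    ((hi F).add (hi G)).const_mul 2
  let D : X → ℝ := fun x => σ * (‖(F + G) x‖ ^ p.toReal + ‖(F - G) x‖ ^ p.toReal -
    2 * (‖F x‖ ^ p.toReal + ‖G x‖ ^ p.toReal))
  have hD : ∀ᵐ x ∂μ, 0 ≤ D x ∧ (D x = 0 ↔ F x * G x = 0) := by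
    filter_upwards [Lp.coeFn_add F G, Lp.coeFn_sub F G] with x h1 h2
    simp only [D, h1, h2, Pi.add_apply, Pi.sub_apply]
    exact hσ _ _
  have hDint : ∫ x, D x ∂μ = σ * (‖F + G‖ ^ p.toReal + ‖F - G‖ ^ p.toReal -
      2 * (‖F‖ ^ p.toReal + ‖G‖ ^ p.toReal)) := by
    simp only [D]
    rw [integral_const_mul, integral_sub hI1 hI2, integral_add (hi _) (hi _), integral_const_mul,
      integral_add (hi _) (hi _)]
    simp only [Lp_norm_rpow_eq_integral hp]
  have hkey : (∀ᵐ x ∂μ, F x * G x = 0) ↔ ∫ x, D x ∂μ = 0 := by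
    rw [integral_eq_zero_iff_of_nonneg_ae (hD.mono fun x hx => hx.1) ((hI1.sub hI2).const_mul σ)]
    constructor
    · intro h
      filter_upwards [h, hD] with x h1 h2
      exact h2.2.2 h1
    · intro h
      filter_upwards [h, hD] with x h1 h2
      exact h2.2.1 h1
  rw [hkey, hDint, mul_eq_zero, or_iff_right hσ0, sub_eq_zero]

end Clarkson

/-! ### Generators of isometry groups on the range of a projection -/

section Multiplier

variable {X : Type*} [MeasurableSpace X] {μ : Measure X} {p : ℝ≥0∞} [hp1 : Fact (1 ≤ p)]
  {e T : Lp ℂ p μ →L[ℂ] Lp ℂ p μ} {U : ℝ → Lp ℂ p μ →L[ℂ] Lp ℂ p μ}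

/-- The contractions `U t` form a norm continuous group of isometries of the range of the projection
`e`, with infinitesimal generator `i T`. -/
structure IsIsometryGroupOn (e T : Lp ℂ p μ →L[ℂ] Lp ℂ p μ) (U : ℝ → Lp ℂ p μ →L[ℂ] Lp ℂ p μ) :
    Prop where
  norm_le : ∀ t, ‖U t‖ ≤ 1
  apply_neg : ∀ t F, U (-t) (U t F) = e F
  zero : U 0 = e
  proj_apply : ∀ t F, e (U t F) = U t F
  proj_gen : ∀ F, e (T F) = T F
  hasDerivAt : HasDerivAt U (Complex.I • T) 0

/-- `T` acts on every fixed point of `e` as multiplication by a real function. This function may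
depend on the fixed point. -/
def IsRealMultiplierOn (e T : Lp ℂ p μ →L[ℂ] Lp ℂ p μ) : Prop :=
  ∀ F, e F = F → ∃ m : X → ℝ, T F =ᵐ[μ] fun x => m x * F x

lemma IsIsometryGroupOn.norm_apply (h : IsIsometryGroupOn e T U) {F : Lp ℂ p μ} (hF : e F = F)
    (t : ℝ) : ‖U t F‖ = ‖F‖ := by
  refine le_antisymm (by simpa using (U t).le_of_opNorm_le (h.norm_le t) F) ?_
  have := (U (-t)).le_of_opNorm_le (h.norm_le (-t)) (U t F)
  rwa [h.apply_neg, hF, one_mul] at this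

lemma IsIsometryGroupOn.neg (h : IsIsometryGroupOn e T U) :
    IsIsometryGroupOn e (-T) (fun t => U (-t)) where
  norm_le t := h.norm_le _
  apply_neg t F := h.apply_neg _ _
  zero := by simpa using h.zero
  proj_apply t F := h.proj_apply _ _
  proj_gen F := by simp [h.proj_gen F]
  hasDerivAt := by
    have h1 : HasDerivAt (fun t : ℝ => -t) (-1) 0 := (hasDerivAt_id (0 : ℝ)).neg
    have h2 := HasDerivAt.scomp (h := fun t : ℝ => -t) (0 : ℝ) (by simpa using h.hasDerivAt) h1
    simpa [Function.comp_def] using h2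

lemma IsIsometryGroupOn.hasDerivAt_apply (h : IsIsometryGroupOn e T U) (F : Lp ℂ p μ) :
    HasDerivAt (fun t => U t F) (Complex.I • T F) 0 := by
  have := ((ContinuousLinearMap.apply ℂ (Lp ℂ p μ) F).restrictScalars ℝ).hasFDerivAt.comp_hasDerivAt
    (0 : ℝ) h.hasDerivAt
  simpa [Function.comp_def] using this

lemma IsIsometryGroupOn.mul_ae_eq_zero (h : IsIsometryGroupOn e T U) (hp : p ≠ ∞) (hp2 : p ≠ 2)
    {F G : Lp ℂ p μ} (hF : e F = F) (hG : e G = G) (hFG : ∀ᵐ x ∂μ, F x * G x = 0) (t : ℝ) :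
    ∀ᵐ x ∂μ, (U t F) x * (U t G) x = 0 := by
  rw [mul_ae_eq_zero_iff_norm hp hp2] at hFG ⊢
  rw [← map_add, ← map_sub, h.norm_apply (by rw [map_add, hF, hG]),
    h.norm_apply (by rw [map_sub, hF, hG]), h.norm_apply hF, h.norm_apply hG, hFG]

/-- The generator preserves disjointness: `U t F` is near `F` and disjoint from `U t G`, so that on
the support of `F` the difference quotients of `U t G` tend to zero. -/
lemma IsIsometryGroupOn.gen_mul_ae_eq_zero (h : IsIsometryGroupOn e T U) (hp : p ≠ ∞) (hp2 : p ≠ 2)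
    {F G : Lp ℂ p μ} (hF : e F = F) (hG : e G = G) (hFG : ∀ᵐ x ∂μ, F x * G x = 0) :
    ∀ᵐ x ∂μ, F x * (T G) x = 0 := by
  let t : ℕ → ℝ := fun n => 1 / ((n : ℝ) + 1)
  have ht0 : ∀ n, 0 < t n := fun n => by positivity
  have ht : Tendsto t atTop (𝓝[≠] 0) := by
    rw [tendsto_nhdsWithin_iff]
    exact ⟨tendsto_one_div_add_atTop_nhds_zero_nat, .of_forall fun n => (ht0 n).ne'⟩
  have hlimF : Tendsto (fun n => U (t n) F) atTop (𝓝 F) := by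
    have := (h.hasDerivAt_apply F).continuousAt.tendsto.comp
      (tendsto_nhds_of_tendsto_nhdsWithin ht)
    rwa [h.zero, hF] at this
  have hlimG : Tendsto (fun n => ((t n)⁻¹ : ℂ) • (U (t n) G - G)) atTop
      (𝓝 (Complex.I • T G)) := by
    refine ((hasDerivAt_iff_tendsto_slope.1 (h.hasDerivAt_apply G)).comp ht).congr fun n => ?_
    simp only [Function.comp, slope, h.zero, hG, sub_zero, vsub_eq_sub]
    rw [← Complex.ofReal_inv]; rfl
  obtain ⟨ns, hns, hnsF⟩ := (tendstoInMeasure_of_tendsto_Lp hlimF).exists_seq_tendsto_ae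
  obtain ⟨ms, hms, hmsG⟩ := (tendstoInMeasure_of_tendsto_Lp
    (hlimG.comp hns.tendsto_atTop)).exists_seq_tendsto_ae
  have hdisj : ∀ᵐ x ∂μ, ∀ n, (U (t n) F) x * (U (t n) G) x = 0 :=
    ae_all_iff.2 fun n => h.mul_ae_eq_zero hp hp2 hF hG hFG (t n)
  filter_upwards [hnsF, hmsG, hdisj, hFG,
    ae_all_iff.2 fun n => Lp.coeFn_smul ((t n)⁻¹ : ℂ) (U (t n) G - G),
    ae_all_iff.2 fun n => Lp.coeFn_sub (U (t n) G) G, Lp.coeFn_smul Complex.I (T G)]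
    with x h1 h2 h3 h4 h5 h6 h7
  by_cases hF0 : F x = 0
  · rw [hF0, zero_mul]
  have hG0 : G x = 0 := (mul_eq_zero.1 h4).resolve_left hF0
  have h8 : ∀ᶠ i in atTop, (U (t (ns (ms i))) F) x ≠ 0 :=
    (h1.comp hms.tendsto_atTop).eventually_ne hF0
  have h9 : Complex.I * (T G) x = 0 := by
    rw [h7] at h2
    refine tendsto_nhds_unique h2 (tendsto_const_nhds.congr' ?_)
    filter_upwards [h8] with i hi
    simp only [Function.comp]
    rw [h5, Pi.smul_apply, h6, Pi.sub_apply, hG0, (mul_eq_zero.1 (h3 _)).resolve_left hi]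
    simp
  rw [(mul_eq_zero.1 h9).resolve_left Complex.I_ne_zero, mul_zero]

/-- A multiplier with positive imaginary part would make `U (-t) F` grow at a linear rate. -/
lemma IsIsometryGroupOn.ae_eq_zero_of_im_pos (h : IsIsometryGroupOn e T U) (hp : p ≠ ∞)
    {F : Lp ℂ p μ} (hF : e F = F)
    (hm : ∀ᵐ x ∂μ, F x ≠ 0 → ∃ c : ℂ, 0 < c.im ∧ (T F) x = c * F x) : F =ᵐ[μ] 0 := by
  have hP := one_le_toReal_exponent p hp
  set P := p.toReal with hPdef
  let b : X → ℝ := fun x => ((T F) x / F x).im * ‖F x‖ ^ P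
  have hb0 : ∀ᵐ x ∂μ, 0 ≤ b x ∧ (b x = 0 → F x = 0) := by
    filter_upwards [hm] with x hx
    rcases eq_or_ne (F x) 0 with h0 | h0
    · simp [b, h0]
    · obtain ⟨c, hc, hcx⟩ := hx h0
      have : 0 < b x := by
        have := norm_pos_iff.2 h0
        simp only [b, hcx, mul_div_cancel_right₀ _ h0]; positivity
      exact ⟨this.le, fun h' => absurd h' this.ne'⟩
  let ε : ℝ → ℝ := fun t => ‖U (-t) F - F + t • Complex.I • T F‖
  have hε : HasDerivAt ε 0 0 := by
    have h1 := h.neg.hasDerivAt_apply F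
    rw [hasDerivAt_iff_isLittleO] at h1 ⊢
    rw [← Asymptotics.isLittleO_norm_left] at h1
    refine h1.congr_left fun t => ?_
    simp [ε, h.zero, hF]
  have hε0 : ε 0 = 0 := by simp [ε, h.zero, hF]
  -- Bernoulli's inequality bounds the norm of `F - i t T F` from below.
  have hlow : ∀ t : ℝ, 0 < t → ∀ᵐ x ∂μ, ‖F x‖ ^ P + t * b x ≤ ‖(F - t • Complex.I • T F) x‖ ^ P := by
    intro t ht
    filter_upwards [hm, Lp.coeFn_sub F (t • Complex.I • T F), Lp.coeFn_smul t (Complex.I • T F),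
      Lp.coeFn_smul Complex.I (T F)] with x hx h1 h2 h3
    rw [h1, Pi.sub_apply, h2, Pi.smul_apply, h3, Pi.smul_apply]
    rcases eq_or_ne (F x) 0 with h0 | h0
    · simp only [b, h0, norm_zero, Real.zero_rpow (by linarith : P ≠ 0)]
      simp; positivity
    · obtain ⟨c, hc, hcx⟩ := hx h0
      have e1 : F x - t • Complex.I • (T F) x = (1 - t * Complex.I * c) * F x := by
        rw [hcx, Complex.real_smul, smul_eq_mul]; ring
      have e2 : 1 + t * c.im ≤ ‖1 - t * Complex.I * c‖ := by
        refine le_trans (le_of_eq ?_) (Complex.re_le_norm _)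
        simp
      have e3 : 1 + t * c.im ≤ ‖1 - t * Complex.I * c‖ ^ P := by
        calc 1 + t * c.im ≤ (1 + t * c.im) ^ (1 : ℝ) := by rw [Real.rpow_one]
          _ ≤ (1 + t * c.im) ^ P := Real.rpow_le_rpow_of_exponent_le (by nlinarith) hP
          _ ≤ _ := Real.rpow_le_rpow (by positivity) e2 (by linarith)
      rw [e1, norm_mul, Real.mul_rpow (norm_nonneg _) (norm_nonneg _)]
      simp only [b, hcx, mul_div_cancel_right₀ _ h0]
      calc _ = (1 + t * c.im) * ‖F x‖ ^ P := by ring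
        _ ≤ _ := by gcongr
  have hFi := Lp_integrable_norm_rpow hp F
  have hbi : Integrable b μ := by
    have hbm : AEStronglyMeasurable b μ := by
      refine Measurable.aestronglyMeasurable ?_
      exact (Complex.measurable_im.comp ((Lp.stronglyMeasurable (T F)).measurable.div
        (Lp.stronglyMeasurable F).measurable)).mul
        ((Lp.stronglyMeasurable F).measurable.norm.pow_const P)
    refine (Lp_integrable_norm_rpow hp (F - (1 : ℝ) • Complex.I • T F)).mono' hbm ?_
    filter_upwards [hlow 1 one_pos, hb0] with x h1 h2
    rw [Real.norm_of_nonneg h2.1]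
    have : 0 ≤ ‖F x‖ ^ P := by positivity
    linarith
  have hup : ∀ t : ℝ, 0 < t → ∫ x, b x ∂μ ≤ slope (fun t => (‖F‖ + ε t) ^ P) 0 t := by
    intro t ht
    have h1 : ‖F - t • Complex.I • T F‖ ≤ ‖F‖ + ε t := by
      have : F - t • Complex.I • T F = U (-t) F - (U (-t) F - F + t • Complex.I • T F) := by abel
      rw [this]
      refine (norm_sub_le _ _).trans_eq ?_
      rw [h.norm_apply hF]
    have h2 : ∫ x, (‖F x‖ ^ P + t * b x) ∂μ ≤ (‖F‖ + ε t) ^ P := by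
      calc _ ≤ ∫ x, ‖(F - t • Complex.I • T F) x‖ ^ P ∂μ :=
            integral_mono_ae (hFi.add (hbi.const_mul t)) (Lp_integrable_norm_rpow hp _) (hlow t ht)
        _ = ‖F - t • Complex.I • T F‖ ^ P := (Lp_norm_rpow_eq_integral hp _).symm
        _ ≤ _ := Real.rpow_le_rpow (norm_nonneg _) h1 (by linarith)
    rw [integral_add hFi (hbi.const_mul t), integral_const_mul,
      ← Lp_norm_rpow_eq_integral hp] at h2
    rw [slope_def_field, hε0, sub_zero, add_zero, le_div_iff₀ ht]
    linarith
  have hder : HasDerivAt (fun t => (‖F‖ + ε t) ^ P) 0 0 := by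
    have := (hε.const_add ‖F‖).rpow_const (p := P) (Or.inr hP)
    simpa using this
  have hint : ∫ x, b x ∂μ ≤ 0 := by
    have h1 := hasDerivAt_iff_tendsto_slope.1 hder
    have h2 : Tendsto (slope (fun t => (‖F‖ + ε t) ^ P) 0) (𝓝[>] 0) (𝓝 0) :=
      h1.mono_left (nhdsWithin_mono _ fun t ht => (ne_of_gt ht))
    refine ge_of_tendsto h2 ?_
    filter_upwards [self_mem_nhdsWithin] with t ht
    exact hup t ht
  have hbz := (integral_eq_zero_iff_of_nonneg_ae (hb0.mono fun x hx => hx.1) hbi).1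
    (le_antisymm hint (integral_nonneg_of_ae (hb0.mono fun x hx => hx.1)))
  filter_upwards [hbz, hb0] with x h1 h2
  exact h2.2 h1

lemma IsIsometryGroupOn.gen_eq_zero (h : IsIsometryGroupOn e T U) (hp : p ≠ ∞) (hp2 : p ≠ 2)
    (hloc : IsLocalizable (fixedFunctions e)) {F : Lp ℂ p μ} (hF : e F = F) :
    ∀ᵐ x ∂μ, F x = 0 → (T F) x = 0 := by
  obtain ⟨R, hR, hRT⟩ := hloc.restrict F (coeFn_mem_fixedFunctions hF) (T F)
    (coeFn_mem_fixedFunctions (h.proj_gen F))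
  -- The part `T F - R` of `T F` off the support of `F` is disjoint from `F`, hence from `T F`.
  have h1 := h.gen_mul_ae_eq_zero hp hp2 (F := T F - R) (G := F)
    (by rw [map_sub, hR, h.proj_gen]) hF (by
      filter_upwards [hRT, Lp.coeFn_sub (T F) R] with x x1 x2
      rw [x2, Pi.sub_apply, x1]
      by_cases h0 : F x = 0
      · rw [h0, mul_zero]
      · rw [Set.indicator_of_mem (by exact h0), sub_self, zero_mul])
  filter_upwards [h1, hRT, Lp.coeFn_sub (T F) R] with x x1 x2 x3 h0
  rw [x3, Pi.sub_apply, x2, Set.indicator_of_notMem (by simpa using h0), sub_zero] at x1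
  exact mul_self_eq_zero.1 x1

lemma IsIsometryGroupOn.im_nonpos (h : IsIsometryGroupOn e T U) (hp : p ≠ ∞) (hp2 : p ≠ 2)
    (hloc : IsLocalizable (fixedFunctions e)) {F : Lp ℂ p μ} (hF : e F = F) :
    ∀ᵐ x ∂μ, ((T F) x * conj (F x)).im ≤ 0 := by
  obtain ⟨R, hR, hRF⟩ := hloc.restrict_im F (coeFn_mem_fixedFunctions hF) (T F)
    (coeFn_mem_fixedFunctions (h.proj_gen F))
  have hFR : e (F - R) = F - R := by rw [map_sub, hF, hR]
  have h1 := h.gen_mul_ae_eq_zero hp hp2 hR hFR (by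
    filter_upwards [hRF, Lp.coeFn_sub F R] with x x1 x2
    rw [x2, Pi.sub_apply, x1, Set.indicator_apply]
    split_ifs <;> simp)
  have h2 := h.ae_eq_zero_of_im_pos hp hR (by
    filter_upwards [h1, hRF, Lp.coeFn_sub (T F) (T R)] with x x1 x2 x3 h0
    rw [map_sub, x3, Pi.sub_apply] at x1
    have x4 : (T F) x = (T R) x := sub_eq_zero.1 ((mul_eq_zero.1 x1).resolve_left h0)
    rw [x2, Set.indicator_apply] at h0
    split_ifs at h0 with hc
    · rw [Set.indicator_apply, if_pos hc] at x2
      have hFx : (0 : ℝ) < Complex.normSq (F x) := Complex.normSq_pos.2 h0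
      refine ⟨(T F) x / F x, ?_, by rw [x2, div_mul_cancel₀ _ h0, x4]⟩
      have e2 : ((T F) x * conj (F x)).im = ((T F) x / F x).im * Complex.normSq (F x) := by
        rw [← Complex.im_mul_ofReal, ← Complex.mul_conj, ← mul_assoc, div_mul_cancel₀ _ h0]
      have hc' : 0 < ((T F) x * conj (F x)).im := hc
      rw [e2] at hc'
      exact (mul_pos_iff_of_pos_right hFx).1 hc'
    · exact absurd rfl h0)
  filter_upwards [h2, hRF] with x x1 x2
  by_contra hc
  rw [x1, Set.indicator_of_mem (by exact not_le.1 hc)] at x2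
  rw [← x2] at hc
  simp at hc

/-- For `p ≠ 2`, the generator of an isometry group on a localizable space acts by real multipliers:
as it preserves disjointness, `T F` is supported on the support of `F`, and a nonzero imaginary part
of `T F / F` could be isolated by restricting `F` to the set where it is positive or negative. -/
theorem IsIsometryGroupOn.isRealMultiplierOn (h : IsIsometryGroupOn e T U) (hp : p ≠ ∞)
    (hp2 : p ≠ 2) (hloc : IsLocalizable (fixedFunctions e)) : IsRealMultiplierOn e T := by
  intro F hF
  refine ⟨fun x => ((T F) x / F x).re, ?_⟩
  filter_upwards [h.gen_eq_zero hp hp2 hloc hF, h.im_nonpos hp hp2 hloc hF,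
    h.neg.im_nonpos hp hp2 hloc hF, Lp.coeFn_neg (T F)] with x h0 h1 h2 h3
  rcases eq_or_ne (F x) 0 with hF0 | hF0
  · simp [hF0, h0 hF0]
  · rw [neg_apply, h3, Pi.neg_apply, neg_mul, Complex.neg_im] at h2
    have e2 : ((T F) x * conj (F x)).im = ((T F) x / F x).im * Complex.normSq (F x) := by
      rw [← Complex.im_mul_ofReal, ← Complex.mul_conj, ← mul_assoc, div_mul_cancel₀ _ hF0]
    have h4 : ((T F) x * conj (F x)).im = 0 := by linarith
    rw [e2, mul_eq_zero, or_iff_left (Complex.normSq_pos.2 hF0).ne'] at h4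
    have h5 : (((T F) x / F x).re : ℂ) = (T F) x / F x := Complex.ext (by simp) (by simp [h4])
    rw [h5, div_mul_cancel₀ _ hF0]

end Multiplier

/-! ### Hermitian elements of Banach algebras -/

section Hermitian

variable {A : Type*} [NormedRing A] [NormedAlgebra ℂ A]

lemma exp_mul_exp_neg [CompleteSpace A] (x : A) :
    NormedSpace.exp x * NormedSpace.exp (-x) = 1 := by
  let _ : NormedAlgebra ℚ A := NormedAlgebra.restrictScalars ℚ ℂ A
  rw [← NormedSpace.exp_add_of_commute (Commute.neg_right (Commute.refl x)), add_neg_cancel,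
    NormedSpace.exp_zero]

lemma isHermitianElement_of_norm_le [CompleteSpace A] [NormOneClass A] {a : A}
    (h : ∀ t : ℝ, ‖NormedSpace.exp ((Complex.I * (t : ℂ)) • a)‖ ≤ 1) : IsHermitianElement a := by
  intro t
  refine le_antisymm (h t) ?_
  have h1 := norm_mul_le (NormedSpace.exp ((Complex.I * (t : ℂ)) • a))
    (NormedSpace.exp (-((Complex.I * (t : ℂ)) • a)))
  rw [exp_mul_exp_neg, norm_one] at h1
  have h2 : ‖NormedSpace.exp (-((Complex.I * (t : ℂ)) • a))‖ ≤ 1 := by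
    have := h (-t)
    rwa [Complex.ofReal_neg, mul_neg, neg_smul] at this
  have := mul_le_mul_of_nonneg_left h2 (norm_nonneg (NormedSpace.exp ((Complex.I * (t : ℂ)) • a)))
  linarith

lemma IsHermitianElement.real_smul {a : A} (h : IsHermitianElement a) (r : ℝ) :
    IsHermitianElement ((r : ℂ) • a) := by
  intro t
  rw [smul_smul, mul_assoc, ← Complex.ofReal_mul]
  exact h _

lemma IsHermitianElement.neg {a : A} (h : IsHermitianElement a) : IsHermitianElement (-a) := by
  simpa using h.real_smul (-1)

lemma isHermitianElement_zero [NormOneClass A] : IsHermitianElement (0 : A) := by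
  intro t; simp

lemma isHermitianElement_one [CompleteSpace A] [NormOneClass A] : IsHermitianElement (1 : A) := by
  intro t
  let _ : NormedAlgebra ℚ A := NormedAlgebra.restrictScalars ℚ ℂ A
  have h1 := NormedSpace.map_exp (algebraMap ℂ A) (continuous_algebraMap ℂ A)
    (Complex.I * (t : ℂ))
  rw [Algebra.algebraMap_eq_smul_one (Complex.I * (t : ℂ))] at h1
  rw [← h1, ← Complex.exp_eq_exp_ℂ, norm_algebraMap', mul_comm, Complex.norm_exp_ofReal_mul_I]

lemma isClosed_hermitianElements [CompleteSpace A] : IsClosed (hermitianElements A) := by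
  let _ : NormedAlgebra ℚ A := NormedAlgebra.restrictScalars ℚ ℂ A
  have : hermitianElements A =
      ⋂ t : ℝ, {a : A | ‖NormedSpace.exp ((Complex.I * (t : ℂ)) • a)‖ = 1} := by
    ext a; simp [hermitianElements, IsHermitianElement]
  rw [this]
  refine isClosed_iInter fun t => isClosed_eq ?_ continuous_const
  exact (NormedSpace.exp_continuous.comp (continuous_const_smul _)).norm

lemma core_smul_I_mem {x : A} (hx : x ∈ core A) : Complex.I • x ∈ core A := by
  obtain ⟨a, ha, b, hb, rfl⟩ := hx
  refine ⟨-b, IsHermitianElement.neg hb, a, ha, ?_⟩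
  rw [smul_add, smul_smul, Complex.I_mul_I, neg_smul, one_smul, add_comm]

lemma hermitian_mem_core [NormOneClass A] {x : A} (hx : x ∈ hermitianElements A) : x ∈ core A :=
  ⟨x, hx, 0, isHermitianElement_zero, by simp⟩

lemma core_add_mem (hadd : ∀ a ∈ hermitianElements A, ∀ b ∈ hermitianElements A,
    a + b ∈ hermitianElements A) {x y : A} (hx : x ∈ core A) (hy : y ∈ core A) :
    x + y ∈ core A := by
  obtain ⟨a, ha, b, hb, rfl⟩ := hx
  obtain ⟨c, hc, d, hd, rfl⟩ := hy
  refine ⟨a + c, hadd a ha c hc, b + d, hadd b hb d hd, ?_⟩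
  rw [smul_add]; abel

lemma core_mul_mem [NormOneClass A]
    (hadd : ∀ a ∈ hermitianElements A, ∀ b ∈ hermitianElements A, a + b ∈ hermitianElements A)
    (hmul : ∀ a ∈ hermitianElements A, ∀ b ∈ hermitianElements A, a * b ∈ core A) {x y : A}
    (hx : x ∈ core A) (hy : y ∈ core A) : x * y ∈ core A := by
  obtain ⟨a, ha, b, hb, rfl⟩ := hx
  obtain ⟨c, hc, d, hd, rfl⟩ := hy
  have : (a + Complex.I • b) * (c + Complex.I • d) =
      (a * c + Complex.I • (a * d)) + Complex.I • (b * c + Complex.I • (b * d)) := by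
    simp only [add_mul, mul_add, smul_mul_assoc, mul_smul_comm, smul_add]
    abel
  rw [this]
  exact core_add_mem hadd (core_add_mem hadd (hmul a ha c hc) (core_smul_I_mem (hmul a ha d hd)))
    (core_smul_I_mem (core_add_mem hadd (hmul b hb c hc) (core_smul_I_mem (hmul b hb d hd))))

lemma isClosed_core [CompleteSpace A]
    (hadd : ∀ a ∈ hermitianElements A, ∀ b ∈ hermitianElements A, a + b ∈ hermitianElements A)
    (hnorm : ∀ a ∈ hermitianElements A, ∀ b ∈ hermitianElements A, ‖a‖ ≤ ‖a + Complex.I • b‖) :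
    IsClosed (core A) := by
  let S : Set (A × A) := hermitianElements A ×ˢ hermitianElements A
  have hS : IsClosed S := isClosed_hermitianElements.prod isClosed_hermitianElements
  have : CompleteSpace S := hS.completeSpace_coe
  let f : S → A := fun z => z.1.1 + Complex.I • z.1.2
  have hf : AntilipschitzWith 1 f := by
    refine AntilipschitzWith.of_le_mul_dist fun z w => ?_
    have h1 : z.1.1 - w.1.1 ∈ hermitianElements A := by
      rw [sub_eq_add_neg]; exact hadd _ z.2.1 _ (IsHermitianElement.neg w.2.1)
    have h2 : z.1.2 - w.1.2 ∈ hermitianElements A := by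
      rw [sub_eq_add_neg]; exact hadd _ z.2.2 _ (IsHermitianElement.neg w.2.2)
    have e : f z - f w = (z.1.1 - w.1.1) + Complex.I • (z.1.2 - w.1.2) := by
      simp only [f, smul_sub]; abel
    have h3 := hnorm _ h1 _ h2
    have h4 := hnorm _ h2 _ (IsHermitianElement.neg h1)
    have h5 : (z.1.2 - w.1.2) + Complex.I • -(z.1.1 - w.1.1) = (-Complex.I) • (f z - f w) := by
      rw [e, smul_add, smul_smul, neg_mul, Complex.I_mul_I, neg_neg, one_smul, smul_neg, neg_smul]
      abel
    rw [h5, norm_smul, norm_neg, Complex.norm_I, one_mul] at h4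
    rw [← e] at h3
    rw [NNReal.coe_one, one_mul, dist_eq_norm, Subtype.dist_eq, Prod.dist_eq, dist_eq_norm,
      dist_eq_norm]
    exact max_le h3 h4
  have hfc : UniformContinuous f := by
    have h1 : UniformContinuous fun z : S => z.1 := uniformContinuous_subtype_val
    exact (uniformContinuous_fst.comp h1).add
      ((uniformContinuous_snd.comp h1).const_smul Complex.I)
  have : core A = Set.range f := by
    ext x
    constructor
    · rintro ⟨a, ha, b, hb, rfl⟩
      exact ⟨⟨(a, b), ha, hb⟩, rfl⟩
    · rintro ⟨z, rfl⟩
      exact ⟨_, z.2.1, _, z.2.2, rfl⟩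
  rw [this]
  exact hf.isClosed_range hfc

lemma isHermitianElement_coe_iff [CompleteSpace A] {B : Subalgebra ℂ A}
    (hB : IsClosed (B : Set A)) (b : B) : IsHermitianElement (b : A) ↔ IsHermitianElement b := by
  have : CompleteSpace B := hB.completeSpace_coe
  let _ : NormedAlgebra ℚ A := NormedAlgebra.restrictScalars ℚ ℂ A
  let _ : NormedAlgebra ℚ B := NormedAlgebra.restrictScalars ℚ ℂ B
  refine forall_congr' fun t => ?_
  have h := NormedSpace.map_exp B.val continuous_subtype_val ((Complex.I * (t : ℂ)) • b)
  rw [map_smul] at h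
  change _ = NormedSpace.exp ((Complex.I * (t : ℂ)) • (b : A)) at h
  rw [← h]
  rfl

/-- Conditions on the hermitian elements under which the core is a unital C⋆-subalgebra. It then is the
largest one, since hermitian elements of a closed subalgebra are hermitian in the whole algebra. -/
theorem exists_isGreatest_core [CompleteSpace A] [NormOneClass A]
    (hadd : ∀ a ∈ hermitianElements A, ∀ b ∈ hermitianElements A, a + b ∈ hermitianElements A)
    (hmul : ∀ a ∈ hermitianElements A, ∀ b ∈ hermitianElements A, a * b ∈ core A)
    (hnorm : ∀ a ∈ hermitianElements A, ∀ b ∈ hermitianElements A, ‖a‖ ≤ ‖a + Complex.I • b‖) :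
    ∃ C : Subalgebra ℂ A, (C : Set A) = core A ∧
      IsGreatest {B : Subalgebra ℂ A | IsUnitalCStarSubalgebra B} C := by
  let C : Subalgebra ℂ A :=
    { carrier := core A
      mul_mem' := core_mul_mem hadd hmul
      add_mem' := core_add_mem hadd
      algebraMap_mem' := fun z =>
        ⟨_, isHermitianElement_one.real_smul z.re, _, isHermitianElement_one.real_smul z.im, by
          rw [smul_smul, ← add_smul, mul_comm, Complex.re_add_im, Algebra.algebraMap_eq_smul_one]⟩ }
  have hC : (C : Set A) = core A := rfl
  have hCc : IsClosed (C : Set A) := hC ▸ isClosed_core hadd hnorm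
  refine ⟨C, hC, ⟨hCc, ?_⟩, ?_⟩
  · refine Set.eq_univ_of_forall fun x => ?_
    obtain ⟨a, ha, b, hb, hx⟩ : (x : A) ∈ core A := x.2
    refine ⟨⟨a, hermitian_mem_core ha⟩, (isHermitianElement_coe_iff hCc _).1 ha,
      ⟨b, hermitian_mem_core hb⟩, (isHermitianElement_coe_iff hCc _).1 hb, Subtype.ext hx⟩
  · intro B hB x hx
    obtain ⟨a, ha, b, hb, hab⟩ : (⟨x, hx⟩ : B) ∈ core B := by
      rw [hB.core_eq_univ]; trivial
    exact ⟨a, (isHermitianElement_coe_iff hB.isClosed a).2 ha, b,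
      (isHermitianElement_coe_iff hB.isClosed b).2 hb, congrArg Subtype.val hab⟩

lemma hasDerivAt_exp_I_smul [CompleteSpace A] (a : A) (t : ℝ) :
    HasDerivAt (fun t : ℝ => NormedSpace.exp ((Complex.I * (t : ℂ)) • a))
      (Complex.I • (a * NormedSpace.exp ((Complex.I * (t : ℂ)) • a))) t := by
  have h := hasDerivAt_exp_smul_const' (𝕂 := ℝ) (Complex.I • a) t
  have e : ∀ s : ℝ, s • Complex.I • a = (Complex.I * (s : ℂ)) • a := fun s => by
    rw [mul_comm, mul_smul]; rfl
  simp only [e] at h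
  rwa [smul_mul_assoc] at h

end Hermitian

/-! ### Isometric representations on `L^p` -/

section Representation

variable {A : Type*} [NormedRing A] [NormedAlgebra ℂ A]
  {X : Type*} [MeasurableSpace X] {μ : Measure X} {p : ℝ≥0∞} [hp1 : Fact (1 ≤ p)]
  {φ : A →ₙₐ[ℂ] (Lp ℂ p μ →L[ℂ] Lp ℂ p μ)}

lemma norm_map_of_isometry (hφ : Isometry φ) (a : A) : ‖φ a‖ = ‖a‖ := by
  simpa using hφ.norm_map_of_map_zero (map_zero φ) a

lemma map_mul_apply (a b : A) (F : Lp ℂ p μ) : φ (a * b) F = φ a (φ b F) := by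
  rw [map_mul]; rfl

lemma norm_le_of_norm_apply_fixed_le [NormOneClass A] (hφ : Isometry φ) {a : A} {c : ℝ} (hc : 0 ≤ c)
    (h : ∀ F, φ 1 F = F → ‖φ a F‖ ≤ c * ‖F‖) : ‖a‖ ≤ c := by
  rw [← norm_map_of_isometry hφ]
  refine ContinuousLinearMap.opNorm_le_bound _ hc fun F => ?_
  have h1 := h (φ 1 F) (by rw [← map_mul_apply, one_mul])
  rw [← map_mul_apply, mul_one] at h1
  refine h1.trans ?_
  have h2 := (φ 1).le_of_opNorm_le (norm_map_of_isometry hφ 1).le F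
  rw [norm_one, one_mul] at h2
  gcongr

variable [CompleteSpace A]

lemma IsHermitianElement.isIsometryGroupOn (hφ : Isometry φ) {a : A} (ha : IsHermitianElement a) :
    IsIsometryGroupOn (φ 1) (φ a)
      (fun t => φ (NormedSpace.exp ((Complex.I * (t : ℂ)) • a))) where
  norm_le t := by rw [norm_map_of_isometry hφ, ha t]
  apply_neg t F := by
    rw [← map_mul_apply]
    congr 2
    have := exp_mul_exp_neg (-((Complex.I * (t : ℂ)) • a))
    rw [neg_neg] at this
    rwa [Complex.ofReal_neg, mul_neg, neg_smul]
  zero := by simp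
  proj_apply t F := by rw [← map_mul_apply, one_mul]
  proj_gen F := by rw [← map_mul_apply, one_mul]
  hasDerivAt := by
    let φL : A →L[ℂ] (Lp ℂ p μ →L[ℂ] Lp ℂ p μ) :=
      ⟨{ toFun := φ, map_add' := map_add φ, map_smul' := map_smul φ }, hφ.continuous⟩
    have h := ((φL.restrictScalars ℝ).hasFDerivAt).comp_hasDerivAt (0 : ℝ)
      (hasDerivAt_exp_I_smul a 0)
    simpa [φL, Function.comp_def] using h

end Representation

/-! ### Real multipliers -/

section RealMultiplier

variable {X : Type*} [MeasurableSpace X] {μ : Measure X} {p : ℝ≥0∞} [hp1 : Fact (1 ≤ p)]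
  {e S T : Lp ℂ p μ →L[ℂ] Lp ℂ p μ}

lemma IsRealMultiplierOn.add (hS : IsRealMultiplierOn e S) (hT : IsRealMultiplierOn e T) :
    IsRealMultiplierOn e (S + T) := by
  intro F hF
  obtain ⟨m, hm⟩ := hS F hF
  obtain ⟨n, hn⟩ := hT F hF
  refine ⟨m + n, ?_⟩
  filter_upwards [hm, hn, Lp.coeFn_add (S F) (T F)] with x h1 h2 h3
  rw [add_apply, h3, Pi.add_apply, h1, h2, Pi.add_apply]
  push_cast; ring

lemma IsRealMultiplierOn.mul (hS : IsRealMultiplierOn e S) (hT : IsRealMultiplierOn e T)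
    (heT : ∀ F, e (T F) = T F) : IsRealMultiplierOn e (S * T) := by
  intro F hF
  obtain ⟨n, hn⟩ := hT F hF
  obtain ⟨m, hm⟩ := hS (T F) (heT F)
  refine ⟨m * n, ?_⟩
  filter_upwards [hm, hn] with x h1 h2
  change (S (T F)) x = _
  rw [h1, h2, Pi.mul_apply]
  push_cast; ring

/-- All fixed points share the same multiplier. By polarization, `(T F) * conj F` being real for every
fixed point `F` makes `(T F) * conj G` symmetric in `F` and `G`. -/
lemma IsRealMultiplierOn.mul_comm_apply (hT : IsRealMultiplierOn e T) {F G : Lp ℂ p μ}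
    (hF : e F = F) (hG : e G = G) : ∀ᵐ x ∂μ, (T F) x * G x = F x * (T G) x := by
  obtain ⟨m, hm⟩ := hT F hF
  obtain ⟨n, hn⟩ := hT G hG
  obtain ⟨k, hk⟩ := hT (F + G) (by rw [map_add, hF, hG])
  obtain ⟨l, hl⟩ := hT (F + Complex.I • G) (by rw [map_add, map_smul, hF, hG])
  rw [map_add] at hk
  rw [map_add, map_smul] at hl
  filter_upwards [hm, hn, hk, hl, Lp.coeFn_add F G, Lp.coeFn_add (T F) (T G),
    Lp.coeFn_add F (Complex.I • G), Lp.coeFn_add (T F) (Complex.I • T G),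
    Lp.coeFn_smul Complex.I G, Lp.coeFn_smul Complex.I (T G)] with x hm hn hk hl x1 x2 x3 x4 x5 x6
  rw [x1, x2, Pi.add_apply, Pi.add_apply, hm, hn] at hk
  rw [x3, x4, Pi.add_apply, Pi.add_apply, x5, x6, Pi.smul_apply, Pi.smul_apply, hm, hn,
    smul_eq_mul, smul_eq_mul] at hl
  rw [hm, hn]
  by_cases hmn : m x = n x
  · rw [hmn]; ring
  -- If the multipliers differ, both `F x / G x` and `F x / (i G x)` are real.
  by_cases hG0 : G x = 0
  · simp [hG0]
  by_cases hF0 : F x = 0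
  · simp [hF0]
  exfalso
  have hmk : m x - k x ≠ 0 := by
    intro h
    have h' : (m x : ℂ) = k x := by exact_mod_cast sub_eq_zero.1 h
    have : ((n x - k x : ℝ) : ℂ) * G x = 0 := by
      push_cast; linear_combination hk - F x * h'
    rcases mul_eq_zero.1 this with h2 | h2
    · exact hmn (by have : n x - k x = 0 := by exact_mod_cast h2
                    linarith)
    · exact hG0 h2
  have hml : m x - l x ≠ 0 := by
    intro h
    have h' : (m x : ℂ) = l x := by exact_mod_cast sub_eq_zero.1 h
    have : ((n x - l x : ℝ) : ℂ) * (Complex.I * G x) = 0 := by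
      push_cast; linear_combination hl - F x * h'
    rcases mul_eq_zero.1 this with h2 | h2
    · exact hmn (by have : n x - l x = 0 := by exact_mod_cast h2
                    linarith)
    · exact (mul_ne_zero Complex.I_ne_zero hG0) h2
  have hmk' : ((m x - k x : ℝ) : ℂ) ≠ 0 := by exact_mod_cast hmk
  have hml' : ((m x - l x : ℝ) : ℂ) ≠ 0 := by exact_mod_cast hml
  have e1 : F x / G x = (((k x - n x) / (m x - k x) : ℝ) : ℂ) := by
    rw [div_eq_iff hG0, Complex.ofReal_div, div_mul_eq_mul_div, eq_div_iff hmk']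
    push_cast; linear_combination hk
  have e2 : F x / G x = (((l x - n x) / (m x - l x) : ℝ) : ℂ) * Complex.I := by
    rw [div_eq_iff hG0, Complex.ofReal_div, mul_assoc, div_mul_eq_mul_div, eq_div_iff hml']
    push_cast; linear_combination hl
  have h1 : ((k x - n x) / (m x - k x) : ℝ) = 0 := by
    have := congrArg Complex.re (e1.symm.trans e2)
    simpa only [Complex.ofReal_re, Complex.re_ofReal_mul, Complex.I_re, mul_zero] using this
  rw [h1, Complex.ofReal_zero, div_eq_zero_iff] at e1
  exact e1.elim hF0 hG0

lemma IsRealMultiplierOn.apply_comm (hS : IsRealMultiplierOn e S) (hT : IsRealMultiplierOn e T)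
    (heS : ∀ F, e (S F) = S F) (heT : ∀ F, e (T F) = T F) {F : Lp ℂ p μ} (hF : e F = F) :
    S (T F) = T (S F) := by
  obtain ⟨m, hm⟩ := hS F hF
  obtain ⟨n, hn⟩ := hT F hF
  obtain ⟨k, hk⟩ := hS (T F) (heT F)
  obtain ⟨l, hl⟩ := hT (S F) (heS F)
  apply Lp.ext
  filter_upwards [hm, hn, hk, hl, hS.mul_comm_apply (heT F) hF, hT.mul_comm_apply (heS F) hF]
    with x h1 h2 h3 h4 h5 h6
  by_cases hF0 : F x = 0
  · rw [h3, h4, h1, h2, hF0]; simp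
  · apply mul_right_cancel₀ hF0
    rw [h5, h6, mul_comm]

lemma IsRealMultiplierOn.norm_apply_le (hS : IsRealMultiplierOn e S) (hT : IsRealMultiplierOn e T)
    {F : Lp ℂ p μ} (hF : e F = F) : ‖S F‖ ≤ ‖(S + Complex.I • T) F‖ := by
  obtain ⟨m, hm⟩ := hS F hF
  obtain ⟨n, hn⟩ := hT F hF
  refine Lp.norm_le_norm_of_ae_le ?_
  filter_upwards [hm, hn, Lp.coeFn_add (S F) (Complex.I • T F), Lp.coeFn_smul Complex.I (T F)]
    with x h1 h2 h3 h4
  rw [add_apply, smul_apply, h3, Pi.add_apply, h4, Pi.smul_apply, h1, h2, smul_eq_mul,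
    show (m x * F x + Complex.I * (n x * F x) : ℂ) = (m x + n x * Complex.I) * F x by ring,
    norm_mul, norm_mul]
  gcongr
  have := Complex.abs_re_le_norm (m x + n x * Complex.I)
  simpa using this

/-- Multiplication by a real function commutes with the other multiplications, so that the powers of
`T` multiply `F` by the powers of its multiplier. -/
lemma IsRealMultiplierOn.apply_of_eq_mul (hT : IsRealMultiplierOn e T) {F G : Lp ℂ p μ}
    (hF : e F = F) (hG : e G = G) {m : X → ℝ} (hm : T F =ᵐ[μ] fun x => m x * F x) {c : X → ℂ}
    (hc : G =ᵐ[μ] fun x => c x * F x) : T G =ᵐ[μ] fun x => (m x * c x) * F x := by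
  obtain ⟨n, hn⟩ := hT G hG
  filter_upwards [hm, hc, hn, hT.mul_comm_apply hF hG] with x h1 h2 h3 h4
  by_cases hF0 : F x = 0
  · rw [h3, h2, hF0]; simp
  · apply mul_left_cancel₀ hF0
    rw [← h4, h1, h2]; ring

end RealMultiplier

section RepresentationMultiplier

variable {A : Type*} [NormedRing A] [NormedAlgebra ℂ A]
  {X : Type*} [MeasurableSpace X] {μ : Measure X} {p : ℝ≥0∞} [hp1 : Fact (1 ≤ p)]
  {φ : A →ₙₐ[ℂ] (Lp ℂ p μ →L[ℂ] Lp ℂ p μ)}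

lemma IsRealMultiplierOn.map_pow_apply {a : A} (h : IsRealMultiplierOn (φ 1) (φ a)) {F : Lp ℂ p μ}
    (hF : φ 1 F = F) {m : X → ℝ} (hm : φ a F =ᵐ[μ] fun x => m x * F x) (z : ℂ) (n : ℕ) :
    φ ((z • a) ^ n) F =ᵐ[μ] fun x => (z * m x) ^ n * F x := by
  induction n with
  | zero => simp [hF]
  | succ n ih =>
    have h1 := h.apply_of_eq_mul hF (G := φ ((z • a) ^ n) F)
      (by rw [← map_mul_apply, one_mul]) hm ih
    have e : φ ((z • a) ^ (n + 1)) F = z • φ a (φ ((z • a) ^ n) F) := by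
      rw [pow_succ', map_mul_apply, map_smul]; rfl
    rw [e]
    filter_upwards [h1, Lp.coeFn_smul z (φ a (φ ((z • a) ^ n) F))] with x h2 h3
    rw [h3, Pi.smul_apply, h2, smul_eq_mul, pow_succ]; ring

/-- If `φ a` multiplies `F` by the real function `m`, then `φ (exp (i t a))` multiplies it by the
unimodular function `exp (i t m)`. -/
lemma IsRealMultiplierOn.isHermitianElement [CompleteSpace A] [NormOneClass A] (hφ : Isometry φ) {a : A}
    (h : IsRealMultiplierOn (φ 1) (φ a)) : IsHermitianElement a := by
  refine isHermitianElement_of_norm_le fun t => ?_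
  refine norm_le_of_norm_apply_fixed_le hφ zero_le_one fun F hF => ?_
  rw [one_mul]
  set z : ℂ := Complex.I * t with hz
  obtain ⟨m, hm⟩ := h F hF
  let ev : A →L[ℂ] Lp ℂ p μ :=
    ⟨{ toFun := fun b => φ b F
       map_add' := fun b c => by rw [map_add]; rfl
       map_smul' := fun w b => by rw [map_smul]; rfl },
      (ContinuousLinearMap.apply ℂ (Lp ℂ p μ) F).continuous.comp hφ.continuous⟩
  have hsum := ev.hasSum (NormedSpace.exp_series_hasSum_exp' (𝕂 := ℂ) (z • a))
  obtain ⟨ns, hns, hlim⟩ := (tendstoInMeasure_of_tendsto_Lp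
    hsum.tendsto_sum_nat).exists_seq_tendsto_ae
  have hterm : ∀ᵐ x ∂μ, ∀ n : ℕ, (ev ((n.factorial⁻¹ : ℂ) • (z • a) ^ n)) x =
      ((n.factorial⁻¹ : ℂ) • (z * m x) ^ n) * F x := by
    refine ae_all_iff.2 fun n => ?_
    have e : ev ((n.factorial⁻¹ : ℂ) • (z • a) ^ n) =
      (n.factorial⁻¹ : ℂ) • φ ((z • a) ^ n) F := map_smul ev _ _
    rw [e]
    filter_upwards [h.map_pow_apply hF hm z n,
      Lp.coeFn_smul (n.factorial⁻¹ : ℂ) (φ ((z • a) ^ n) F)] with x h1 h2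
    rw [h2, Pi.smul_apply, h1, smul_eq_mul, smul_eq_mul]; ring
  have hfin : ∀ᵐ x ∂μ, ∀ N : ℕ,
      (∑ n ∈ Finset.range N, ev ((n.factorial⁻¹ : ℂ) • (z • a) ^ n) : Lp ℂ p μ) x =
      ∑ n ∈ Finset.range N, (ev ((n.factorial⁻¹ : ℂ) • (z • a) ^ n)) x :=
    ae_all_iff.2 fun N => Lp.coeFn_fun_finsetSum _ _
  refine Lp.norm_le_norm_of_ae_le ?_
  filter_upwards [hlim, hterm, hfin] with x h1 h2 h3
  have h4 : Tendsto (fun N => ∑ n ∈ Finset.range N, ((n.factorial⁻¹ : ℂ) • (z * m x) ^ n) * F x)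
      atTop (𝓝 (NormedSpace.exp (z * m x) * F x)) :=
    ((NormedSpace.exp_series_hasSum_exp' (𝕂 := ℂ) (z * m x : ℂ)).mul_right
      (F x)).tendsto_sum_nat
  have h5 : (ev (NormedSpace.exp (z • a))) x = NormedSpace.exp (z * m x) * F x := by
    refine tendsto_nhds_unique h1 ((h4.comp hns.tendsto_atTop).congr fun i => ?_)
    rw [h3]
    simp only [Function.comp, h2]
  change ‖(ev (NormedSpace.exp (z • a))) x‖ ≤ _
  rw [h5, norm_mul, ← Complex.exp_eq_exp_ℂ, hz,
    show Complex.I * t * m x = ((t * m x : ℝ) : ℂ) * Complex.I by push_cast; ring,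
    Complex.norm_exp_ofReal_mul_I, one_mul]

/-- For `p ≠ 2`, the hermitian elements of an algebra of operators on `L^p` are those that act by
real multipliers on the range of the unit. -/
theorem isHermitianElement_iff_isRealMultiplierOn [CompleteSpace A] [NormOneClass A] (hp : p ≠ ∞) (hp2 : p ≠ 2)
    (hφ : Isometry φ) (a : A) : IsHermitianElement a ↔ IsRealMultiplierOn (φ 1) (φ a) := by
  refine ⟨fun h => ?_, fun h => h.isHermitianElement hφ⟩
  refine (h.isIsometryGroupOn hφ).isRealMultiplierOn hp hp2
    (isLocalizable_fixedFunctions hp hp2 ?_ fun F => ?_)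
  · rw [norm_map_of_isometry hφ, norm_one]
  · rw [← map_mul_apply, one_mul]

lemma map_injective_of_fixed (hφ : Isometry φ) {a b : A}
    (h : ∀ F, φ 1 F = F → φ a F = φ b F) : a = b := by
  apply hφ.injective
  ext1 F
  have := h (φ 1 F) (by rw [← map_mul_apply, one_mul])
  rwa [← map_mul_apply, ← map_mul_apply, mul_one, mul_one] at this

end RepresentationMultiplier

/-! ### The Hilbert space case -/

section Hilbert

variable {A : Type*} [NormedRing A] [NormedAlgebra ℂ A]
  {X : Type*} [MeasurableSpace X] {μ : Measure X}
  {φ : A →ₙₐ[ℂ] (Lp ℂ 2 μ →L[ℂ] Lp ℂ 2 μ)}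

/-- `T` is symmetric on the space of fixed points of `e`. -/
def IsSymmetricOn (e T : Lp ℂ 2 μ →L[ℂ] Lp ℂ 2 μ) : Prop :=
  ∀ F G, e F = F → e G = G → inner ℂ (T F) G = inner ℂ F (T G)

lemma IsIsometryGroupOn.isSymmetricOn {e T : Lp ℂ 2 μ →L[ℂ] Lp ℂ 2 μ}
    {U : ℝ → Lp ℂ 2 μ →L[ℂ] Lp ℂ 2 μ} (h : IsIsometryGroupOn e T U) : IsSymmetricOn e T := by
  intro F G hF hG
  have hconst : ∀ t, inner ℂ (U t F) (U t G) = inner ℂ F G := by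
    intro t
    have hn : ∀ H, e H = H → ‖U t H‖ = ‖H‖ := fun H hH => h.norm_apply hH t
    rw [inner_eq_sum_norm_sq_div_four, inner_eq_sum_norm_sq_div_four F G]
    simp only [← map_smul, ← map_add, ← map_sub]
    rw [hn, hn, hn, hn] <;> simp [hF, hG]
  have hd := (h.hasDerivAt_apply F).inner ℂ (h.hasDerivAt_apply G)
  simp only [hconst, h.zero, hF, hG] at hd
  have h0 := hd.unique (hasDerivAt_const (0 : ℝ) _)
  rw [inner_smul_right, inner_smul_left, Complex.conj_I] at h0
  have : Complex.I * (inner ℂ (T F) G - inner ℂ F (T G)) = 0 := by linear_combination -h0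
  exact sub_eq_zero.1 ((mul_eq_zero.1 this).resolve_left Complex.I_ne_zero)

lemma IsSymmetricOn.isHermitianElement [CompleteSpace A] [NormOneClass A] (hφ : Isometry φ) {a : A}
    (h : IsSymmetricOn (φ 1) (φ a)) : IsHermitianElement a := by
  refine isHermitianElement_of_norm_le fun t => ?_
  refine norm_le_of_norm_apply_fixed_le hφ zero_le_one fun F hF => ?_
  rw [one_mul]
  let E : ℝ → A := fun s => NormedSpace.exp ((Complex.I * (s : ℂ)) • a)
  let ev : A →L[ℂ] Lp ℂ 2 μ :=
    ⟨{ toFun := fun b => φ b F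
       map_add' := fun b c => by rw [map_add]; rfl
       map_smul' := fun w b => by rw [map_smul]; rfl },
      (ContinuousLinearMap.apply ℂ (Lp ℂ 2 μ) F).continuous.comp hφ.continuous⟩
  have hd : ∀ s, HasDerivAt (fun s => φ (E s) F) (Complex.I • φ a (φ (E s) F)) s := by
    intro s
    have h1 := ((ev.restrictScalars ℝ).hasFDerivAt).comp_hasDerivAt s (hasDerivAt_exp_I_smul a s)
    refine h1.congr_deriv ?_
    change φ (Complex.I • (a * E s)) F = _
    rw [map_smul, ← map_mul_apply]; rfl
  have hd2 : ∀ s, HasDerivAt (fun s => inner ℂ (φ (E s) F) (φ (E s) F)) 0 s := by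
    intro s
    refine ((hd s).inner ℂ (hd s)).congr_deriv ?_
    have hE : φ 1 (φ (E s) F) = φ (E s) F := by rw [← map_mul_apply, one_mul]
    rw [inner_smul_right, inner_smul_left, Complex.conj_I, h _ _ hE hE]
    ring
  have h0 := is_const_of_deriv_eq_zero (fun s => (hd2 s).differentiableAt)
    (fun s => (hd2 s).deriv) t 0
  have hE0 : φ (E 0) F = F := by simp [E, hF]
  rw [hE0, inner_self_eq_norm_sq_to_K, inner_self_eq_norm_sq_to_K] at h0
  have h1 : ‖φ (E t) F‖ ^ 2 = ‖F‖ ^ 2 := by exact_mod_cast h0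
  exact (sq_eq_sq₀ (norm_nonneg _) (norm_nonneg _)).1 h1 |>.le

theorem isHermitianElement_iff_isSymmetricOn [CompleteSpace A] [NormOneClass A] (hφ : Isometry φ) (a : A) :
    IsHermitianElement a ↔ IsSymmetricOn (φ 1) (φ a) :=
  ⟨fun h => (h.isIsometryGroupOn hφ).isSymmetricOn, fun h => h.isHermitianElement hφ⟩

lemma map_add_apply (a b : A) (F : Lp ℂ 2 μ) : φ (a + b) F = φ a F + φ b F := by
  rw [map_add]; rfl

lemma map_smul_apply (c : ℂ) (a : A) (F : Lp ℂ 2 μ) : φ (c • a) F = c • φ a F := by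
  rw [map_smul]; rfl

lemma IsSymmetricOn.add {a b : A} (ha : IsSymmetricOn (φ 1) (φ a))
    (hb : IsSymmetricOn (φ 1) (φ b)) : IsSymmetricOn (φ 1) (φ (a + b)) := by
  intro F G hF hG
  rw [map_add_apply, map_add_apply, inner_add_left, inner_add_right, ha F G hF hG, hb F G hF hG]

lemma IsSymmetricOn.mul_eq {a b : A} (ha : IsSymmetricOn (φ 1) (φ a))
    (hb : IsSymmetricOn (φ 1) (φ b)) {F G : Lp ℂ 2 μ} (hF : φ 1 F = F) (hG : φ 1 G = G) :
    inner ℂ (φ (a * b) F) G = inner ℂ F (φ (b * a) G) := by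
  rw [map_mul_apply, map_mul_apply, ha _ _ (by rw [← map_mul_apply, one_mul]) hG,
    hb _ _ hF (by rw [← map_mul_apply, one_mul])]

/-- The product of two symmetric operators is the sum of its symmetric parts
`(a b + b a) / 2` and `i (a b - b a) / (2 i)`. -/
lemma IsSymmetricOn.mul_mem_core [CompleteSpace A] [NormOneClass A] (hφ : Isometry φ) {a b : A}
    (ha : IsSymmetricOn (φ 1) (φ a)) (hb : IsSymmetricOn (φ 1) (φ b)) : a * b ∈ core A := by
  refine ⟨(1 / 2 : ℂ) • (a * b + b * a), ?_, (Complex.I / 2) • (b * a + (-1 : ℂ) • (a * b)), ?_, ?_⟩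
  · refine IsSymmetricOn.isHermitianElement hφ fun F G hF hG => ?_
    rw [map_smul_apply, map_smul_apply, map_add_apply, map_add_apply, inner_smul_left,
      inner_smul_right, inner_add_left, inner_add_right, ha.mul_eq hb hF hG, hb.mul_eq ha hF hG]
    simp [Complex.conj_ofNat]; ring
  · refine IsSymmetricOn.isHermitianElement hφ fun F G hF hG => ?_
    rw [map_smul_apply, map_smul_apply, map_add_apply, map_add_apply, inner_smul_left,
      inner_smul_right, inner_add_left, inner_add_right, map_smul_apply, map_smul_apply,
      inner_smul_left, inner_smul_right, ha.mul_eq hb hF hG, hb.mul_eq ha hF hG]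
    simp [Complex.conj_ofNat]; ring
  · rw [smul_smul, mul_div_assoc', Complex.I_mul_I, smul_add, smul_add, smul_smul]
    module

lemma IsSymmetricOn.norm_le [NormOneClass A] (hφ : Isometry φ) {a b : A}
    (ha : IsSymmetricOn (φ 1) (φ a)) (hb : IsSymmetricOn (φ 1) (φ b)) :
    ‖a‖ ≤ ‖a + Complex.I • b‖ := by
  -- `a - i b` acts as the adjoint of `a + i b`, so its norm is not larger.
  have hstar : ‖a + (-Complex.I) • b‖ ≤ ‖a + Complex.I • b‖ := by
    refine norm_le_of_norm_apply_fixed_le hφ (norm_nonneg _) fun F hF => ?_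
    have hadj : ∀ G, φ 1 G = G → inner ℂ (φ (a + (-Complex.I) • b) F) G =
        inner ℂ F (φ (a + Complex.I • b) G) := by
      intro G hG
      rw [map_add_apply, map_add_apply, map_smul_apply, map_smul_apply, inner_add_left,
        inner_add_right, inner_smul_left, inner_smul_right, ha F G hF hG, hb F G hF hG]
      simp
    set G := φ (a + (-Complex.I) • b) F with hG
    have h1 := hadj G (by rw [hG, ← map_mul_apply, one_mul])
    have h2 : ‖G‖ * ‖G‖ ≤ ‖F‖ * (‖a + Complex.I • b‖ * ‖G‖) := by
      have h3 : ‖(inner ℂ G G : ℂ)‖ ≤ ‖F‖ * ‖φ (a + Complex.I • b) G‖ := by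
        rw [h1]; exact norm_inner_le_norm _ _
      rw [inner_self_eq_norm_sq_to_K] at h3
      have h4 := (φ (a + Complex.I • b)).le_opNorm G
      rw [norm_map_of_isometry hφ] at h4
      calc ‖G‖ * ‖G‖ = ‖((‖G‖ : ℂ)) ^ 2‖ := by simp [sq]
        _ ≤ _ := h3
        _ ≤ _ := by gcongr
    rcases (norm_nonneg G).eq_or_lt with h5 | h5
    · rw [← h5]; positivity
    · refine le_of_mul_le_mul_right ?_ h5
      linarith
  have e : a = (1 / 2 : ℂ) • ((a + Complex.I • b) + (a + (-Complex.I) • b)) := by module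
  calc ‖a‖ = ‖(1 / 2 : ℂ) • ((a + Complex.I • b) + (a + (-Complex.I) • b))‖ := by rw [← e]
    _ = 1 / 2 * ‖(a + Complex.I • b) + (a + (-Complex.I) • b)‖ := by rw [norm_smul]; norm_num
    _ ≤ 1 / 2 * (‖a + Complex.I • b‖ + ‖a + (-Complex.I) • b‖) := by gcongr; exact norm_add_le _ _
    _ ≤ _ := by linarith

end Hilbert

theorem theorem2 (p : ℝ≥0∞) [Fact (1 ≤ p)] (hp : p ≠ ∞)
    (A : Type u) [NormedRing A] [NormedAlgebra ℂ A] [CompleteSpace A] [NormOneClass A]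
    (hA : IsLpOperatorAlgebra.{u, v} p A) :
    (∃ C : Subalgebra ℂ A, (C : Set A) = core A ∧
      IsGreatest {B : Subalgebra ℂ A | IsUnitalCStarSubalgebra B} C) ∧
    (p ≠ 2 → ∀ x ∈ core A, ∀ y ∈ core A, x * y = y * x) := by
  obtain ⟨X, _, μ, φ, hφ⟩ := hA
  rcases eq_or_ne p 2 with rfl | hp2
  · have key := isHermitianElement_iff_isSymmetricOn hφ
    refine ⟨exists_isGreatest_core ?_ ?_ ?_, fun h => absurd rfl h⟩
    · exact fun a ha b hb => (key _).2 (((key a).1 ha).add ((key b).1 hb))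
    · exact fun a ha b hb => ((key a).1 ha).mul_mem_core hφ ((key b).1 hb)
    · exact fun a ha b hb => ((key a).1 ha).norm_le hφ ((key b).1 hb)
  · have key := isHermitianElement_iff_isRealMultiplierOn hp hp2 hφ
    have hfix : ∀ (a : A) (F : Lp ℂ p μ), φ 1 (φ a F) = φ a F := fun a F => by
      rw [← map_mul_apply, one_mul]
    have hcomm : ∀ a ∈ hermitianElements A, ∀ b ∈ hermitianElements A, a * b = b * a := by
      intro a ha b hb
      refine map_injective_of_fixed hφ fun F hF => ?_
      rw [map_mul_apply, map_mul_apply]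
      exact ((key a).1 ha).apply_comm ((key b).1 hb) (hfix a) (hfix b) hF
    refine ⟨exists_isGreatest_core ?_ ?_ ?_, ?_⟩
    · intro a ha b hb
      refine (key _).2 ?_
      rw [map_add]
      exact ((key a).1 ha).add ((key b).1 hb)
    · intro a ha b hb
      refine hermitian_mem_core ((key _).2 ?_)
      rw [map_mul]
      exact ((key a).1 ha).mul ((key b).1 hb) (hfix b)
    · intro a ha b hb
      refine norm_le_of_norm_apply_fixed_le hφ (norm_nonneg _) fun F hF => ?_
      refine (((key a).1 ha).norm_apply_le ((key b).1 hb) hF).trans ?_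
      rw [← map_smul, ← map_add, ← norm_map_of_isometry hφ]
      exact ContinuousLinearMap.le_opNorm _ _
    · rintro - _ ⟨a, ha, b, hb, rfl⟩ _ ⟨c, hc, d, hd, rfl⟩
      simp only [add_mul, mul_add, smul_mul_assoc, mul_smul_comm, smul_add, hcomm a ha c hc, hcomm a ha d hd,
        hcomm b hb c hc, hcomm b hb d hd]
      abel
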